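/- Let $D\subseteq\mathbb R^3$ be open, let $f\in C^\infty(D)$, and consider the second-order ODE $$y''=f(x,y,y'),\qquad (x,y,y')\in D. \tag{1}$$ Let $(x_0,y_0)$ be a point such that $(x_0,y_0,p)\in D$ for some $p$. For an open $U\subseteq\mathbb R^2$ write $D_U=\{(x,y,p)\in D:(x,y)\in U\}$. *Definitions.* The ODE (1) is linearizable by a point transformation near $(x_0,y_0)$ if there are an open neighbourhood $U$ of $(x_0,y_0)$ and smooth functions $t=\phi(x,y)$, $u=\psi(x,y)$ on $U$ with $J=\phi_x\psi_y-\phi_y\psi_x\ne 0$ on $U$ whose second prolongation transforms (1) over $U$ (at the jets with $\phi_x+\phi_y y'\neq 0$) into a linear equation $u_{tt}=a(t)u_t+b(t)u+c(t)$ with smooth coefficients. For a vector field $v=\xi(x,y)\partial_x+\eta(x,y)\partial_y$ on $U$ and a smooth function $\lambda(x,y,p)$ on $D_U$, put $\eta^{(1)}=D_x\eta-pD_x\xi+\lambda(\eta-\xi p)$ and $\eta^{(2)}=D_x\eta^{(1)}-qD_x\xi+\lambda(\eta^{(1)}-\xi q)$, where $p=y'$, $q=y''$ and $D_x$ is the total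 derivative. The pair $(v,\lambda)$ is a $\lambda$-symmetry of (1) over $U$ if $\eta^{(2)}=\xi f_x+\eta f_y+\eta^{(1)}f_p$ on $D_U$ when $q=f$. Two pairs $(v,\lambda)$, $(v',\lambda')$ are equivalent over $U$ if at each point of $D_U$ the vectors $\xi\partial_x+\eta\partial_y+\eta^{(1)}\partial_p$ and $\xi'\partial_x+\eta'\partial_y+\eta'^{(1)}\partial_p$ span, each together with $A=\partial_x+p\,\partial_y+f\,\partial_p$, the same subspace. *Statement.* (i) The ODE (1) is linearizable by a point transformation near $(x_0,y_0)$ if and only if there are an open neighbourhood $U$ of $(x_0,y_0)$ and smooth functions $F_3,F_2,F_1,F,w,z$ of $(x,y)$ on $U$ such that, over $U$, (a) (1) has the form $y''+F_3y'^3+F_2y'^2+F_1y'+F=0$; (b) (1) admits a $\lambda$-symmetry equivalent to the canonical pair $(\partial_y,\lambda_1)$, where $\lambda_1=-F_3y'^2-(F_2-w)y'-z$; (c) $w_x+z_y=\frac13\left(\frac{\partial F_2}{\partial x}+\frac{\partial F_1}{\partial y}\right)$. (ii) Whenever $U,F_3,F_2,F_1,F,w,z$ are as in (i), with (a), (b),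 (c), the system $$S_{yy}+(2w-F_2)S_y+F_3S_x=0,\quad S_{xy}+wS_x-zS_y=0,\quad S_{xx}+(F_1-2z)S_x-FS_y=0$$ has two functionally independent smooth solutions $\phi,\psi$ (that is, $\phi_x\psi_y-\phi_y\psi_x\ne0$ everywhere; in particular they are non-constant) on some open neighbourhood $V\subseteq U$ of $(x_0,y_0)$. Moreover, any two smooth solutions $\phi,\psi$ of this system on an open $V\subseteq U$ with $\phi_x\psi_y-\phi_y\psi_x\neq0$ on $V$ give a point transformation $t=\phi(x,y)$, $u=\psi(x,y)$ that transforms (1) over $V$ into the free particle equation $u_{tt}=0$. -/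

import Mathlib

open scoped ContDiff

namespace PointLin

/-! ### Partial derivatives and total derivatives

A point of the plane is `(x, y)`; a point of the first jet space is `(x, y, p)`, where `p` stands
for `y'`; the coordinate of the second jet space above it, standing for `y''`, is called `q`. -/

/-- `∂g/∂x` for a function of `(x, y)`. -/
noncomputable def dx (g : ℝ × ℝ → ℝ) (m : ℝ × ℝ) : ℝ := deriv (fun s => g (s, m.2)) m.1

/-- `∂g/∂y` for a function of `(x, y)`. -/
noncomputable def dy (g : ℝ × ℝ → ℝ) (m : ℝ × ℝ) : ℝ := deriv (fun s => g (m.1, s)) m.2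

/-- The point `(x, y)` below the jet `(x, y, p)`. -/
def base (j : ℝ × ℝ × ℝ) : ℝ × ℝ := (j.1, j.2.1)

/-- `∂G/∂x` for a function of `(x, y, p)`. -/
noncomputable def jx (G : ℝ × ℝ × ℝ → ℝ) (j : ℝ × ℝ × ℝ) : ℝ :=
  deriv (fun s => G (s, j.2.1, j.2.2)) j.1

/-- `∂G/∂y` for a function of `(x, y, p)`. -/
noncomputable def jy (G : ℝ × ℝ × ℝ → ℝ) (j : ℝ × ℝ × ℝ) : ℝ :=
  deriv (fun s => G (j.1, s, j.2.2)) j.2.1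

/-- `∂G/∂p` for a function of `(x, y, p)`. -/
noncomputable def jp (G : ℝ × ℝ × ℝ → ℝ) (j : ℝ × ℝ × ℝ) : ℝ :=
  deriv (fun s => G (j.1, j.2.1, s)) j.2.2

/-- Total derivative `D_x g = g_x + p g_y` of a function of `(x, y)`, at the jet `(x, y, p)`. -/
noncomputable def total (g : ℝ × ℝ → ℝ) (j : ℝ × ℝ × ℝ) : ℝ :=
  dx g (base j) + j.2.2 * dy g (base j)

/-- Total derivative `D_x G = G_x + p G_y + q G_p` of a function of `(x, y, p)`, at the second
order jet `(x, y, p, q)`. -/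
noncomputable def total₁ (G : ℝ × ℝ × ℝ → ℝ) (j : ℝ × ℝ × ℝ) (q : ℝ) : ℝ :=
  jx G j + j.2.2 * jy G j + q * jp G j

/-! ### Point transformations -/

/-- The Jacobian `J = φ_x ψ_y - φ_y ψ_x` of `t = φ(x, y)`, `u = ψ(x, y)`. -/
noncomputable def jacobian (φ ψ : ℝ × ℝ → ℝ) (m : ℝ × ℝ) : ℝ :=
  dx φ m * dy ψ m - dy φ m * dx ψ m

/-- `(φ, ψ)` is a smooth point transformation on `U`: its Jacobian vanishes nowhere on `U`. -/
structure IsPointTransformation (U : Set (ℝ × ℝ)) (φ ψ : ℝ × ℝ → ℝ) : Prop where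
  smooth_fst : ContDiffOn ℝ ∞ φ U
  smooth_snd : ContDiffOn ℝ ∞ ψ U
  jacobian_ne : ∀ m ∈ U, jacobian φ ψ m ≠ 0

/-- The transformed first derivative `du/dt = D_x ψ / D_x φ`. -/
noncomputable def newDeriv (φ ψ : ℝ × ℝ → ℝ) (j : ℝ × ℝ × ℝ) : ℝ := total ψ j / total φ j

/-- The transformed second derivative `d²u/dt² = D_x (du/dt) / D_x φ`. -/
noncomputable def newDeriv₂ (φ ψ : ℝ × ℝ → ℝ) (j : ℝ × ℝ × ℝ) (q : ℝ) : ℝ :=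
  total₁ (newDeriv φ ψ) j q / total φ j

/-- Over `U`, the change of variables `t = φ(x, y)`, `u = ψ(x, y)` turns the equation
`y'' = f(x, y, y')`, `(x, y, y') ∈ D`, into the linear equation
`d²u/dt² = a(t) du/dt + b(t) u + c(t)`: the second prolongation of the transformation identifies
the two equations at all jets at which it is defined, that is, where `D_x φ ≠ 0`. -/
def TransformsTo (D : Set (ℝ × ℝ × ℝ)) (f : ℝ × ℝ × ℝ → ℝ) (U : Set (ℝ × ℝ))
    (φ ψ : ℝ × ℝ → ℝ) (a b c : ℝ → ℝ) : Prop :=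
  ∀ j ∈ D, base j ∈ U → total φ j ≠ 0 → ∀ q : ℝ,
    q = f j ↔
      newDeriv₂ φ ψ j q =
        a (φ (base j)) * newDeriv φ ψ j + b (φ (base j)) * ψ (base j) + c (φ (base j))

/-- Near the point `m`, the equation `y'' = f(x, y, y')`, `(x, y, y') ∈ D`, can be mapped by a
point transformation to some linear second order equation with smooth coefficients. -/
def LinearizableAt (D : Set (ℝ × ℝ × ℝ)) (f : ℝ × ℝ × ℝ → ℝ) (m : ℝ × ℝ) : Prop :=
  ∃ (U : Set (ℝ × ℝ)) (φ ψ : ℝ × ℝ → ℝ) (T : Set ℝ) (a b c : ℝ → ℝ),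
    IsOpen U ∧ m ∈ U ∧ IsPointTransformation U φ ψ ∧
    IsOpen T ∧ Set.MapsTo φ U T ∧
    ContDiffOn ℝ ∞ a T ∧ ContDiffOn ℝ ∞ b T ∧ ContDiffOn ℝ ∞ c T ∧
    TransformsTo D f U φ ψ a b c

/-! ### `λ`-symmetries -/

/-- First `λ`-prolongation coefficient of `ξ ∂_x + η ∂_y`:
`η⁽¹⁾ = D_x η - p D_x ξ + λ (η - ξ p)`. -/
noncomputable def prolong₁ (ξ η : ℝ × ℝ → ℝ) (l : ℝ × ℝ × ℝ → ℝ) (j : ℝ × ℝ × ℝ) : ℝ :=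
  total η j - j.2.2 * total ξ j + l j * (η (base j) - ξ (base j) * j.2.2)

/-- Second `λ`-prolongation coefficient of `ξ ∂_x + η ∂_y`:
`η⁽²⁾ = D_x η⁽¹⁾ - q D_x ξ + λ (η⁽¹⁾ - ξ q)`. -/
noncomputable def prolong₂ (ξ η : ℝ × ℝ → ℝ) (l : ℝ × ℝ × ℝ → ℝ) (j : ℝ × ℝ × ℝ) (q : ℝ) : ℝ :=
  total₁ (prolong₁ ξ η l) j q - q * total ξ j + l j * (prolong₁ ξ η l j - ξ (base j) * q)

/-- `(ξ ∂_x + η ∂_y, λ)` is a `λ`-symmetry, over `U`, of `y'' = f(x, y, y')`, `(x, y, y') ∈ D`: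
the second `λ`-prolongation annihilates `q - f(x, y, p)` wherever `q = f(x, y, p)`. -/
structure IsLambdaSymmetry (D : Set (ℝ × ℝ × ℝ)) (f : ℝ × ℝ × ℝ → ℝ) (U : Set (ℝ × ℝ))
    (ξ η : ℝ × ℝ → ℝ) (l : ℝ × ℝ × ℝ → ℝ) : Prop where
  smooth_fst : ContDiffOn ℝ ∞ ξ U
  smooth_snd : ContDiffOn ℝ ∞ η U
  smooth_lambda : ContDiffOn ℝ ∞ l (D ∩ base ⁻¹' U)
  invariant : ∀ j ∈ D, base j ∈ U → ∀ q : ℝ, q = f j →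
    prolong₂ ξ η l j q -
      (ξ (base j) * jx f j + η (base j) * jy f j + prolong₁ ξ η l j * jp f j) = 0

/-- The first `λ`-prolongation `ξ ∂_x + η ∂_y + η⁽¹⁾ ∂_p` as a vector at the jet `j`. -/
noncomputable def prolongVec (ξ η : ℝ × ℝ → ℝ) (l : ℝ × ℝ × ℝ → ℝ) (j : ℝ × ℝ × ℝ) : ℝ × ℝ × ℝ :=
  (ξ (base j), η (base j), prolong₁ ξ η l j)

/-- The vector field `A = ∂_x + p ∂_y + f ∂_p` of the equation, as a vector at the jet `j`. -/
def odeVec (f : ℝ × ℝ × ℝ → ℝ) (j : ℝ × ℝ × ℝ) : ℝ × ℝ × ℝ := (1, j.2.2, f j)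

/-- Equivalence of the pairs `(ξ ∂_x + η ∂_y, λ)` and `(ξ' ∂_x + η' ∂_y, λ')` for the equation
`y'' = f(x, y, y')` over `U`: together with the vector field `A` of the equation, their first
prolongations span the same distribution. -/
def PairEquiv (D : Set (ℝ × ℝ × ℝ)) (f : ℝ × ℝ × ℝ → ℝ) (U : Set (ℝ × ℝ))
    (ξ η : ℝ × ℝ → ℝ) (l : ℝ × ℝ × ℝ → ℝ) (ξ' η' : ℝ × ℝ → ℝ) (l' : ℝ × ℝ × ℝ → ℝ) : Prop :=
  ∀ j ∈ D, base j ∈ U →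
    Submodule.span ℝ {odeVec f j, prolongVec ξ η l j} =
      Submodule.span ℝ {odeVec f j, prolongVec ξ' η' l' j}

/-! ### The criterion -/

/-- `λ₁ = -F₃ p² - (F₂ - w) p - z`. -/
def lambda₁ (F₃ F₂ w z : ℝ × ℝ → ℝ) (j : ℝ × ℝ × ℝ) : ℝ :=
  -F₃ (base j) * j.2.2 ^ 2 - (F₂ (base j) - w (base j)) * j.2.2 - z (base j)

/-- Over `U`, the equation `y'' = f(x, y, y')`, `(x, y, y') ∈ D`, is
`y'' + F₃ y'³ + F₂ y'² + F₁ y' + F = 0`, it admits a `λ`-symmetry equivalent to the canonical pair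
`(∂_y, λ₁)`, and `w_x + z_y = (1/3) (∂F₂/∂x + ∂F₁/∂y)`. -/
structure Criterion (D : Set (ℝ × ℝ × ℝ)) (f : ℝ × ℝ × ℝ → ℝ) (U : Set (ℝ × ℝ))
    (F₃ F₂ F₁ F w z : ℝ × ℝ → ℝ) : Prop where
  smooth_F₃ : ContDiffOn ℝ ∞ F₃ U
  smooth_F₂ : ContDiffOn ℝ ∞ F₂ U
  smooth_F₁ : ContDiffOn ℝ ∞ F₁ U
  smooth_F : ContDiffOn ℝ ∞ F U
  smooth_w : ContDiffOn ℝ ∞ w U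
  smooth_z : ContDiffOn ℝ ∞ z U
  cubic : ∀ j ∈ D, base j ∈ U →
    f j + F₃ (base j) * j.2.2 ^ 3 + F₂ (base j) * j.2.2 ^ 2 + F₁ (base j) * j.2.2
      + F (base j) = 0
  symmetry : ∃ (ξ η : ℝ × ℝ → ℝ) (l : ℝ × ℝ × ℝ → ℝ),
    IsLambdaSymmetry D f U ξ η l ∧
      PairEquiv D f U ξ η l (fun _ => 0) (fun _ => 1) (lambda₁ F₃ F₂ w z)
  auxiliary : ∀ m ∈ U, dx w m + dy z m = (1 / 3) * (dx F₂ m + dy F₁ m)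

/-- `S` is a smooth solution on `V` of the system
`S_yy + (2w - F₂) S_y + F₃ S_x = 0`, `S_xy + w S_x - z S_y = 0`,
`S_xx + (F₁ - 2z) S_x - F S_y = 0`. -/
structure SolvesSystem (V : Set (ℝ × ℝ)) (F₃ F₂ F₁ F w z S : ℝ × ℝ → ℝ) : Prop where
  smooth : ContDiffOn ℝ ∞ S V
  eq_yy : ∀ m ∈ V, dy (dy S) m + (2 * w m - F₂ m) * dy S m + F₃ m * dx S m = 0
  eq_xy : ∀ m ∈ V, dy (dx S) m + w m * dx S m - z m * dy S m = 0
  eq_xx : ∀ m ∈ V, dx (dx S) m + (F₁ m - 2 * z m) * dx S m - F m * dy S m = 0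

end PointLin

/-! Two solutions of the system with nonzero Jacobian turn the transformed second derivative into
`J (q + F₃ p³ + F₂ p² + F₁ p + F) / (D_x φ)³`, so `t = φ`, `u = ψ` maps the cubic equation to
`u_tt = 0`. The system expresses all second derivatives of `S` through `S_x` and `S_y`: it is a
linear total differential equation `dY = Γ Y` for `Y = (S, S_x, S_y)`. Whether a pair equivalent
to `(∂_y, λ₁)` is a `λ`-symmetry is decided by `λ₁` alone: a quadratic polynomial in `p` has to
vanish. The vanishing of its three coefficients, together with condition (c), says that the
connection `Γ` is flat, and Frobenius' theorem then yields solutions with arbitrary initial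
gradient, in particular two independent ones.

Conversely, a linear equation is straightened to `ũ_t̃t̃ = 0` by a change
`t̃ = τ(t)`, `ũ = ρ(t) u + σ(t)`, so a linearizable equation has a transformation `(φ, ψ)` to the
free particle equation. Cramer's rule gives coefficients for which `φ` and `ψ` solve the system,
the formula above identifies `f` with the cubic, and the equality of the mixed third derivatives
of `φ` and `ψ` forces flatness. -/

open Set Metric
open scoped Topology

namespace PointLin

/-! ### Frobenius' theorem -/

section Frobenius

variable {E F G : Type*} [NormedAddCommGroup E] [NormedSpace ℝ E]
  [NormedAddCommGroup F] [NormedSpace ℝ F] [NormedAddCommGroup G] [NormedSpace ℝ G]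

/-- Uniform bounds, on `s`, for a map and for the remainders of its Taylor approximations of
orders zero and one. -/
structure HasTaylorBoundsOn (A : E → G) (C : ℝ) (s : Set E) : Prop where
  norm_le : ∀ m ∈ s, ‖A m‖ ≤ C
  norm_sub_le : ∀ m ∈ s, ∀ m' ∈ s, ‖A m' - A m‖ ≤ C * ‖m' - m‖
  norm_sub_sub_fderiv_le : ∀ m ∈ s, ∀ m' ∈ s,
    ‖A m' - A m - fderiv ℝ A m (m' - m)‖ ≤ C * ‖m' - m‖ ^ 2

theorem HasTaylorBoundsOn.mono {A : E → G} {C : ℝ} {s t : Set E} (h : HasTaylorBoundsOn A C t)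
    (hst : s ⊆ t) : HasTaylorBoundsOn A C s :=
  ⟨fun m hm => h.norm_le m (hst hm),
    fun m hm m' hm' => h.norm_sub_le m (hst hm) m' (hst hm'),
    fun m hm m' hm' => h.norm_sub_sub_fderiv_le m (hst hm) m' (hst hm')⟩

theorem norm_sub_sub_fderiv_le_of_lipschitzOnWith {A : E → G} {K : NNReal} {s : Set E}
    (hs : Convex ℝ s) (hd : ∀ m ∈ s, DifferentiableAt ℝ A m)
    (hK : LipschitzOnWith K (fderiv ℝ A) s) {m m' : E} (hm : m ∈ s) (hm' : m' ∈ s) :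
    ‖A m' - A m - fderiv ℝ A m (m' - m)‖ ≤ K * ‖m' - m‖ ^ 2 := by
  have hseg : segment ℝ m m' ⊆ s := hs.segment_subset hm hm'
  have hbound : ∀ x ∈ segment ℝ m m', ‖fderiv ℝ A x - fderiv ℝ A m‖ ≤ K * ‖m' - m‖ :=
    fun x hx => (hK.norm_sub_le (hseg hx) hm).trans
      (mul_le_mul_of_nonneg_left (norm_sub_le_of_mem_segment hx) K.2)
  rw [pow_two, ← mul_assoc]
  exact (convex_segment m m').norm_image_sub_le_of_norm_fderiv_le' (𝕜 := ℝ)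
    (fun x hx => hd x (hseg hx)) hbound (left_mem_segment ℝ m m') (right_mem_segment ℝ m m')

theorem exists_hasTaylorBoundsOn {A : E → G} {m₀ : E} (hA : ContDiffAt ℝ 2 A m₀) :
    ∃ C > 0, ∃ s ∈ 𝓝 m₀, HasTaylorBoundsOn A C s := by
  obtain ⟨K, s, hs, hK⟩ := (hA.of_le one_le_two).exists_lipschitzOnWith
  have hA' : ContDiffAt ℝ 1 (fderiv ℝ A) m₀ := hA.fderiv_right (by norm_num)
  obtain ⟨K', s', hs', hK'⟩ := hA'.exists_lipschitzOnWith
  have hbdd : ∀ᶠ m in 𝓝 m₀, ‖A m‖ < ‖A m₀‖ + 1 :=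
    hA.continuousAt.norm.eventually_lt_const (lt_add_one _)
  have hdiff : ∀ᶠ m in 𝓝 m₀, DifferentiableAt ℝ A m :=
    (hA.eventually (by decide)).mono fun m hm => hm.differentiableAt (by norm_num)
  obtain ⟨r, hr, hball⟩ := Metric.eventually_nhds_iff_ball.1
    (((Filter.eventually_mem_set.2 hs).and (Filter.eventually_mem_set.2 hs')).and
      (hbdd.and hdiff))
  have hKsub := hK.mono fun m hm => (hball m hm).1.1
  have hKsub' := hK'.mono fun m hm => (hball m hm).1.2
  refine ⟨‖A m₀‖ + 1 + K + K', by positivity, ball m₀ r, ball_mem_nhds m₀ hr,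
    fun m hm => ?_, fun m hm m' hm' => ?_, fun m hm m' hm' => ?_⟩
  · linarith [(hball m hm).2.1, K.coe_nonneg, K'.coe_nonneg]
  · refine (hKsub.norm_sub_le hm' hm).trans (mul_le_mul_of_nonneg_right ?_ (norm_nonneg _))
    linarith [norm_nonneg (A m₀), K'.coe_nonneg]
  · refine (norm_sub_sub_fderiv_le_of_lipschitzOnWith (convex_ball m₀ r)
      (fun m hm => (hball m hm).2.2) hKsub' hm hm').trans
      (mul_le_mul_of_nonneg_right ?_ (by positivity))
    linarith [norm_nonneg (A m₀), K.coe_nonneg]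

theorem norm_le_of_norm_hasDerivWithinAt_le {y y' : ℝ → F} {ε : ℝ} (hε : 0 ≤ ε)
    (hy : ∀ s ∈ Icc (0 : ℝ) 1, HasDerivWithinAt y (y' s) (Icc 0 1) s)
    (hy' : ∀ s ∈ Icc (0 : ℝ) 1, ‖y' s‖ ≤ 1 / 2 * ‖y s‖ + ε) {s : ℝ} (hs : s ∈ Icc (0 : ℝ) 1) :
    ‖y s‖ ≤ 2 * ‖y 0‖ + 2 * ε := by
  have hgronwall := norm_le_gronwallBound_of_norm_deriv_right_le
    (fun s hs => (hy s hs).continuousWithinAt)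
    (fun s hs => (hy s ⟨hs.1, hs.2.le⟩).mono_of_mem_nhdsWithin (Icc_mem_nhdsGE_of_mem hs))
    le_rfl (fun s hs => hy' s ⟨hs.1, hs.2.le⟩) s hs
  rw [gronwallBound_of_K_ne_0 (by norm_num)] at hgronwall
  have hexp : Real.exp (1 / 2 * (s - 0)) ≤ 2 := by
    rw [← Real.le_log_iff_exp_le two_pos]
    linarith [hs.2, Real.log_two_gt_d9]
  nlinarith [norm_nonneg (y 0)]

/-- `A`, a field of linear maps `E → End F`, is flat on `U`: the connection form `A` of the linear
total differential equation `dY = A Y` satisfies its integrability condition. -/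
def IsFlatOn (A : E → E →L[ℝ] F →L[ℝ] F) (U : Set E) : Prop :=
  ∀ m ∈ U, ∀ (h k : E) (y : F),
    fderiv ℝ A m h k y + A m k (A m h y) = fderiv ℝ A m k h y + A m h (A m k y)

/-- `y` solves the equation `dY = A Y` restricted to the ray `s ↦ m₀ + s v`, `0 ≤ s ≤ 1`. -/
def IsParallelAlongRay (A : E → E →L[ℝ] F →L[ℝ] F) (m₀ v : E) (y : ℝ → F) : Prop :=
  ∀ s ∈ Icc (0 : ℝ) 1, HasDerivWithinAt y (A (m₀ + s • v) v (y s)) (Icc 0 1) s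

variable {A : E → E →L[ℝ] F →L[ℝ] F} {U : Set E} {m₀ v h : E}

theorem exists_isParallelAlongRay [CompleteSpace F]
    (hA : ContinuousOn (fun s : ℝ => A (m₀ + s • v)) (Icc 0 1))
    (hsmall : ∀ s ∈ Icc (0 : ℝ) 1, ‖A (m₀ + s • v) v‖ ≤ 1 / 2) (Y₀ : F) :
    ∃ y : ℝ → F, y 0 = Y₀ ∧ IsParallelAlongRay A m₀ v y := by
  have hPL : IsPicardLindelof (fun s x => A (m₀ + s • v) v x) (⟨0, by simp⟩ : Icc (0 : ℝ) 1) Y₀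
      (‖Y₀‖₊ + 1) 0 (‖Y₀‖₊ + 1) (1 / 2) := by
    refine ⟨fun s hs => ?_, fun x _ => (hA.clm_apply continuousOn_const).clm_apply
      continuousOn_const, fun s hs x hx => ?_, by simp⟩
    · exact ((A (m₀ + s • v) v).lipschitz.weaken (by exact_mod_cast hsmall s hs)).lipschitzOnWith
    · have hball : ‖x - Y₀‖ ≤ ‖Y₀‖ + 1 := by simpa [dist_eq_norm] using hx
      have htri := norm_le_norm_add_norm_sub' x Y₀
      have hop := (A (m₀ + s • v) v).le_of_opNorm_le (hsmall s hs) x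
      simp only [NNReal.coe_add, coe_nnnorm, NNReal.coe_one]
      linarith
  exact hPL.exists_eq_forall_mem_Icc_hasDerivWithinAt₀

theorem IsParallelAlongRay.norm_le {y : ℝ → F} (hy : IsParallelAlongRay A m₀ v y)
    (hsmall : ∀ s ∈ Icc (0 : ℝ) 1, ‖A (m₀ + s • v) v‖ ≤ 1 / 2) {s : ℝ}
    (hs : s ∈ Icc (0 : ℝ) 1) : ‖y s‖ ≤ 2 * ‖y 0‖ := by
  simpa using norm_le_of_norm_hasDerivWithinAt_le le_rfl hy
    (fun s hs => by simpa using (A (m₀ + s • v) v).le_of_opNorm_le (hsmall s hs) (y s)) hs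

/-- The remainder in the linear equation along the ray of direction `v + h` that is satisfied by
`y' - y - s A_h y`, where `y` and `y'` are parallel along the rays of directions `v` and `v + h`. -/
noncomputable def rayRemainder (A : E → E →L[ℝ] F →L[ℝ] F) (m₀ v h : E) (s : ℝ) (Y : F) : F :=
  (A (m₀ + s • (v + h)) - A (m₀ + s • v) - fderiv ℝ A (m₀ + s • v) (s • h)) v Y +
    (A (m₀ + s • (v + h)) - A (m₀ + s • v)) h Y +
    s • ((A (m₀ + s • (v + h)) - A (m₀ + s • v)) (v + h) (A (m₀ + s • v) h Y) +
      A (m₀ + s • v) h (A (m₀ + s • v) h Y))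

theorem IsParallelAlongRay.hasDerivWithinAt_sub {y y' : ℝ → F}
    (hy : IsParallelAlongRay A m₀ v y) (hy' : IsParallelAlongRay A m₀ (v + h) y')
    (hflat : IsFlatOn A U) {s : ℝ} (hs : s ∈ Icc (0 : ℝ) 1) (hsU : m₀ + s • v ∈ U)
    (hA : DifferentiableAt ℝ A (m₀ + s • v)) :
    HasDerivWithinAt (fun s => y' s - y s - s • A (m₀ + s • v) h (y s))
      (A (m₀ + s • (v + h)) (v + h) (y' s - y s - s • A (m₀ + s • v) h (y s)) +
        rayRemainder A m₀ v h s (y s)) (Icc 0 1) s := by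
  have hray : HasDerivAt (fun s : ℝ => m₀ + s • v) v s := by
    simpa using ((hasDerivAt_id s).smul_const v).const_add m₀
  have hAray : HasDerivAt (fun s : ℝ => A (m₀ + s • v)) (fderiv ℝ A (m₀ + s • v) v) s :=
    HasFDerivAt.comp_hasDerivAt (l := A) s hA.hasFDerivAt hray
  have hAy : HasDerivWithinAt (fun s : ℝ => A (m₀ + s • v) h (y s))
      (fderiv ℝ A (m₀ + s • v) v h (y s) + A (m₀ + s • v) h (A (m₀ + s • v) v (y s)))
      (Icc 0 1) s := by
    simpa using (hAray.clm_apply (hasDerivAt_const s h)).hasDerivWithinAt.clm_apply (hy s hs)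
  refine (((hy' s hs).sub (hy s hs)).sub ((hasDerivWithinAt_id s _).smul hAy)).congr_deriv ?_
  rw [hflat _ hsU v h (y s), rayRemainder]
  simp only [map_sub, map_add, map_smul, sub_apply, add_apply, smul_apply, smul_add, smul_sub,
    id, one_smul]
  abel

theorem HasTaylorBoundsOn.norm_rayRemainder_le {C : ℝ} (hA : HasTaylorBoundsOn A C U)
    (hC : 0 ≤ C) {s : ℝ} (hs : s ∈ Icc (0 : ℝ) 1) (hv : ‖v‖ ≤ 1) (hvh : ‖v + h‖ ≤ 1)
    (hsU : m₀ + s • v ∈ U) (hsU' : m₀ + s • (v + h) ∈ U) (Y : F) :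
    ‖rayRemainder A m₀ v h s Y‖ ≤ (2 * C + 2 * C ^ 2) * ‖Y‖ * ‖h‖ ^ 2 := by
  have hsh : ‖s • h‖ ≤ ‖h‖ := by
    rw [norm_smul, Real.norm_of_nonneg hs.1]
    exact mul_le_of_le_one_left (norm_nonneg _) hs.2
  have hsub : m₀ + s • (v + h) - (m₀ + s • v) = s • h := by rw [smul_add]; abel
  have hbound := hA.norm_le _ hsU
  have hlip := hA.norm_sub_le _ hsU _ hsU'
  have htaylor := hA.norm_sub_sub_fderiv_le _ hsU _ hsU'
  rw [hsub] at hlip htaylor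
  replace hlip := hlip.trans (mul_le_mul_of_nonneg_left hsh hC)
  replace htaylor : _ ≤ C * ‖h‖ ^ 2 := htaylor.trans (by gcongr)
  unfold rayRemainder
  set a := A (m₀ + s • v)
  set δ := A (m₀ + s • (v + h)) - a
  have hAh : ‖a h Y‖ ≤ C * ‖h‖ * ‖Y‖ := (a.le_opNorm₂ h Y).trans (by gcongr)
  have hfst : ‖(δ - fderiv ℝ A (m₀ + s • v) (s • h)) v Y‖ ≤ C * ‖h‖ ^ 2 * 1 * ‖Y‖ :=
    (ContinuousLinearMap.le_opNorm₂ _ v Y).trans (by gcongr)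
  have hsnd : ‖δ h Y‖ ≤ C * ‖h‖ * ‖h‖ * ‖Y‖ := (δ.le_opNorm₂ h Y).trans (by gcongr)
  have hthd : ‖δ (v + h) (a h Y)‖ ≤ C * ‖h‖ * 1 * (C * ‖h‖ * ‖Y‖) :=
    (δ.le_opNorm₂ (v + h) (a h Y)).trans (by gcongr)
  have hfth : ‖a h (a h Y)‖ ≤ C * ‖h‖ * (C * ‖h‖ * ‖Y‖) :=
    (a.le_opNorm₂ h (a h Y)).trans (by gcongr)
  have hsmul : ‖s • (δ (v + h) (a h Y) + a h (a h Y))‖ ≤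
      1 * (C * ‖h‖ * 1 * (C * ‖h‖ * ‖Y‖) + C * ‖h‖ * (C * ‖h‖ * ‖Y‖)) := by
    rw [norm_smul, Real.norm_of_nonneg hs.1]
    exact mul_le_mul hs.2 (norm_add_le_of_le hthd hfth) (norm_nonneg _) zero_le_one
  refine (norm_add_le_of_le (norm_add_le_of_le hfst hsnd) hsmul).trans (le_of_eq ?_)
  ring

theorem add_smul_mem_ball {r s : ℝ} (hv : ‖v‖ < r) (hs : s ∈ Icc (0 : ℝ) 1) :
    m₀ + s • v ∈ ball m₀ r :=
  (convex_ball m₀ r).add_smul_mem (mem_ball_self ((norm_nonneg v).trans_lt hv))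
    (by simpa using hv) hs

theorem HasTaylorBoundsOn.norm_apply_ray_le {C r : ℝ} (hA : HasTaylorBoundsOn A C (ball m₀ r))
    (hC : 0 ≤ C) (hCr : C * r ≤ 1 / 2) (hv : ‖v‖ < r) {s : ℝ} (hs : s ∈ Icc (0 : ℝ) 1) :
    ‖A (m₀ + s • v) v‖ ≤ 1 / 2 :=
  (ContinuousLinearMap.le_of_opNorm_le _ (hA.norm_le _ (add_smul_mem_ball hv hs)) _).trans
    ((mul_le_mul_of_nonneg_left hv.le hC).trans hCr)

theorem IsParallelAlongRay.norm_sub_sub_le {C r : ℝ} {y y' : ℝ → F}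
    (hy : IsParallelAlongRay A m₀ v y) (hA : HasTaylorBoundsOn A C (ball m₀ r))
    (hC : 0 ≤ C) (hr : r ≤ 1) (hCr : C * r ≤ 1 / 2) (hflat : IsFlatOn A (ball m₀ r))
    (hdiff : DifferentiableOn ℝ A (ball m₀ r)) (hv : ‖v‖ < r) (hvh : ‖v + h‖ < r)
    (hy' : IsParallelAlongRay A m₀ (v + h) y') (h0 : y' 0 = y 0) :
    ‖y' 1 - y 1 - A (m₀ + v) h (y 1)‖ ≤ 2 * ((2 * C + 2 * C ^ 2) * (2 * ‖y 0‖)) * ‖h‖ ^ 2 := by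
  have hbound := norm_le_of_norm_hasDerivWithinAt_le
    (ε := (2 * C + 2 * C ^ 2) * (2 * ‖y 0‖) * ‖h‖ ^ 2) (by positivity)
    (fun s hs => hy.hasDerivWithinAt_sub hy' hflat hs (add_smul_mem_ball hv hs)
      (hdiff.differentiableAt (isOpen_ball.mem_nhds (add_smul_mem_ball hv hs))))
    (fun s hs => norm_add_le_of_le
      (ContinuousLinearMap.le_of_opNorm_le _ (hA.norm_apply_ray_le hC hCr hvh hs) _) <|
      (hA.norm_rayRemainder_le hC hs (hv.le.trans hr) (hvh.le.trans hr) (add_smul_mem_ball hv hs)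
        (add_smul_mem_ball hvh hs) (y s)).trans (by
          gcongr; exact hy.norm_le (fun s hs => hA.norm_apply_ray_le hC hCr hv hs) hs))
    (right_mem_Icc.2 zero_le_one)
  simpa [h0, mul_assoc] using hbound

theorem IsParallelAlongRay.eq_of_direction_eq_zero {y : ℝ → F} (hy : IsParallelAlongRay A m₀ 0 y) :
    y 1 = y 0 :=
  constant_of_has_deriv_right_zero (fun s hs => (hy s hs).continuousWithinAt)
    (fun s hs => by
      simpa using (hy s ⟨hs.1, hs.2.le⟩).mono_of_mem_nhdsWithin (Icc_mem_nhdsGE_of_mem hs))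
    1 (right_mem_Icc.2 zero_le_one)

theorem hasFDerivAt_of_norm_sub_sub_le {Y : E → F} {L : E →L[ℝ] F} {m : E} {K : ℝ}
    (hY : ∀ᶠ m' in 𝓝 m, ‖Y m' - Y m - L (m' - m)‖ ≤ K * ‖m' - m‖ ^ 2) : HasFDerivAt Y L m := by
  have hO : (fun m' => Y m' - Y m - L (m' - m)) =O[𝓝 m] fun m' => ‖m' - m‖ ^ 2 :=
    Asymptotics.IsBigO.of_bound K (by simpa using hY)
  exact .of_isLittleO <| hO.trans_isLittleO <|
    (Asymptotics.isLittleO_norm_pow_id one_lt_two).comp_tendsto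
      (tendsto_sub_nhds_zero_iff.2 Filter.tendsto_id)

/-- Bootstrapping: the right-hand side of `dY = A Y` is as regular as `Y`. -/
theorem contDiffOn_of_hasFDerivAt_flip (hU : IsOpen U) (hA : ContDiffOn ℝ ∞ A U) {Y : E → F}
    (hY : ∀ m ∈ U, HasFDerivAt Y ((A m).flip (Y m)) m) : ContDiffOn ℝ ∞ Y U := by
  have hdiff : DifferentiableOn ℝ Y U :=
    fun m hm => (hY m hm).differentiableAt.differentiableWithinAt
  rw [contDiffOn_infty]
  intro n
  induction n with
  | zero => exact contDiffOn_zero.2 hdiff.continuousOn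
  | succ n ih =>
    push_cast
    rw [contDiffOn_succ_iff_fderiv_of_isOpen hU]
    refine ⟨hdiff, by simp, ContDiffOn.congr ?_ fun m hm => (hY m hm).fderiv⟩
    exact ((ContinuousLinearMap.flipₗᵢ ℝ E F F).contDiff.comp_contDiffOn
      (contDiffOn_infty.1 hA n)).clm_apply ih

theorem exists_hasFDerivAt_flip_of_isFlatOn [CompleteSpace F] (hU : IsOpen U)
    (hA : ContDiffOn ℝ 2 A U) (hflat : IsFlatOn A U) (hm₀ : m₀ ∈ U) (Y₀ : F) :
    ∃ (V : Set E) (Y : E → F), IsOpen V ∧ m₀ ∈ V ∧ V ⊆ U ∧ Y m₀ = Y₀ ∧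
      ∀ m ∈ V, HasFDerivAt Y ((A m).flip (Y m)) m := by
  obtain ⟨C, hC, s, hs, hT⟩ := exists_hasTaylorBoundsOn (hA.contDiffAt (hU.mem_nhds hm₀))
  obtain ⟨R, hR, hRs⟩ := Metric.mem_nhds_iff.1 (Filter.inter_mem hs (hU.mem_nhds hm₀))
  obtain ⟨r, hr, hrR, hr1, hCr⟩ : ∃ r > 0, r ≤ R ∧ r ≤ 1 ∧ C * r ≤ 1 / 2 :=
    ⟨min R (min 1 (1 / (2 * C))), by positivity, by simp, by simp,
      (mul_le_mul_of_nonneg_left ((min_le_right _ _).trans (min_le_right _ _)) hC.le).trans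
        (by field_simp; rfl)⟩
  have hball : ball m₀ r ⊆ s ∩ U := (ball_subset_ball hrR).trans hRs
  have hrU : ball m₀ r ⊆ U := hball.trans inter_subset_right
  replace hT := hT.mono (hball.trans inter_subset_left)
  have hray (v : E) (hv : ‖v‖ < r) : ∃ y : ℝ → F, y 0 = Y₀ ∧ IsParallelAlongRay A m₀ v y :=
    exists_isParallelAlongRay
      (hA.continuousOn.comp (by fun_prop) fun t ht => hrU (add_smul_mem_ball hv ht))
      (fun t ht => hT.norm_apply_ray_le hC.le hCr hv ht) Y₀
  choose! y hy0 hy using hray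
  refine ⟨ball m₀ r, fun m => y (m - m₀) 1, isOpen_ball, mem_ball_self hr, hrU, ?_, ?_⟩
  · simpa [hy0 0 (by simpa using hr)] using
      (hy 0 (by simpa using hr)).eq_of_direction_eq_zero
  intro m hm
  refine hasFDerivAt_of_norm_sub_sub_le (K := 2 * ((2 * C + 2 * C ^ 2) * (2 * ‖Y₀‖))) ?_
  filter_upwards [isOpen_ball.mem_nhds hm] with m' hm'
  rw [mem_ball_iff_norm] at hm hm'
  have hsum : m - m₀ + (m' - m) = m' - m₀ := by abel
  have hbound := (hy _ hm).norm_sub_sub_le (y' := y (m' - m₀)) hT hC.le hr1 hCr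
    (fun m hm => hflat m (hrU hm)) ((hA.differentiableOn (by norm_num)).mono hrU) hm
    (by rwa [hsum]) (by rw [hsum]; exact hy _ hm') ((hy0 _ hm').trans (hy0 _ hm).symm)
  rwa [hy0 _ hm, add_sub_cancel] at hbound

end Frobenius

/-! ### Linear total differential equations -/

section LinearODE

variable {F : Type*} [NormedAddCommGroup F] [NormedSpace ℝ F]

theorem isFlatOn_of_real (A : ℝ → ℝ →L[ℝ] F →L[ℝ] F) (T : Set ℝ) : IsFlatOn A T := by
  intro t _ h k y
  rw [← mul_one h, ← mul_one k, ← smul_eq_mul, ← smul_eq_mul]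
  simp only [map_smul, smul_apply]
  rw [smul_comm h k, smul_comm h k]

theorem exists_hasDerivAt_clm_apply [CompleteSpace F] {B : ℝ → F →L[ℝ] F} {T : Set ℝ}
    (hT : IsOpen T) (hB : ContDiffOn ℝ ∞ B T) {t₀ : ℝ} (ht₀ : t₀ ∈ T) (Y₀ : F) :
    ∃ (I : Set ℝ) (Y : ℝ → F), IsOpen I ∧ t₀ ∈ I ∧ I ⊆ T ∧ Y t₀ = Y₀ ∧ ContDiffOn ℝ ∞ Y I ∧
      ∀ t ∈ I, HasDerivAt Y (B t (Y t)) t := by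
  have hA : ContDiffOn ℝ ∞ (fun t => (1 : ℝ →L[ℝ] ℝ).smulRight (B t)) T :=
    contDiffOn_const.smulRight hB
  obtain ⟨I, Y, hI, ht₀I, hIT, hY₀, hY⟩ := exists_hasFDerivAt_flip_of_isFlatOn hT
    (contDiffOn_infty.1 hA 2) (isFlatOn_of_real _ T) ht₀ Y₀
  refine ⟨I, Y, hI, ht₀I, hIT, hY₀, contDiffOn_of_hasFDerivAt_flip hI (hA.mono hIT) hY, ?_⟩
  exact fun t ht => by simpa using (hY t ht).hasDerivAt

/-- On `I`, the smooth function `u`, with derivative `v`, solves `u'' = a u' + b u + c`. -/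
structure SolvesLinearODE (I : Set ℝ) (a b c u v : ℝ → ℝ) : Prop where
  smooth : ContDiffOn ℝ ∞ u I
  hasDerivAt : ∀ t ∈ I, HasDerivAt u (v t) t
  hasDerivAt_deriv : ∀ t ∈ I, HasDerivAt v (a t * v t + b t * u t + c t) t

theorem SolvesLinearODE.mono {I I' : Set ℝ} {a b c u v : ℝ → ℝ}
    (h : SolvesLinearODE I a b c u v) (hI : I' ⊆ I) : SolvesLinearODE I' a b c u v :=
  ⟨h.smooth.mono hI, fun t ht => h.hasDerivAt t (hI ht), fun t ht => h.hasDerivAt_deriv t (hI ht)⟩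

/-- The first order system `(u, v, e)' = (v, a v + b u + c e, 0)`, which is
`u'' = a u' + b u + c` on the solutions with `e = 1`. -/
noncomputable def companion (a b c : ℝ) : ℝ × ℝ × ℝ →L[ℝ] ℝ × ℝ × ℝ :=
  LinearMap.toContinuousLinearMap
    { toFun := fun Y => (Y.2.1, a * Y.2.1 + b * Y.1 + c * Y.2.2, 0)
      map_add' := fun Y Y' => by ext <;> simp; ring
      map_smul' := fun r Y => by ext <;> simp; ring }

theorem companion_apply (a b c : ℝ) (Y : ℝ × ℝ × ℝ) :
    companion a b c Y = (Y.2.1, a * Y.2.1 + b * Y.1 + c * Y.2.2, 0) := rfl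

theorem contDiffOn_companion {a b c : ℝ → ℝ} {T : Set ℝ} (ha : ContDiffOn ℝ ∞ a T)
    (hb : ContDiffOn ℝ ∞ b T) (hc : ContDiffOn ℝ ∞ c T) :
    ContDiffOn ℝ ∞ (fun t => companion (a t) (b t) (c t)) T := by
  refine contDiffOn_clm_apply.2 fun Y => ?_
  simp only [companion_apply]
  fun_prop

theorem exists_solvesLinearODE {a b c : ℝ → ℝ} {T : Set ℝ} (hT : IsOpen T)
    (ha : ContDiffOn ℝ ∞ a T) (hb : ContDiffOn ℝ ∞ b T) (hc : ContDiffOn ℝ ∞ c T) {t₀ : ℝ}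
    (ht₀ : t₀ ∈ T) (u₀ v₀ : ℝ) :
    ∃ (I : Set ℝ) (u v : ℝ → ℝ), IsOpen I ∧ t₀ ∈ I ∧ I ⊆ T ∧ u t₀ = u₀ ∧ v t₀ = v₀ ∧
      SolvesLinearODE I a b c u v := by
  obtain ⟨I, Y, hI, ht₀I, hIT, hY₀, hYsmooth, hY⟩ :=
    exists_hasDerivAt_clm_apply hT (contDiffOn_companion ha hb hc) ht₀ (u₀, v₀, 1)
  obtain ⟨r, hr, hrI⟩ := Metric.isOpen_iff.1 hI t₀ ht₀I
  have hfst (t : ℝ) (ht : t ∈ I) : HasDerivAt (fun t => (Y t).1) (Y t).2.1 t :=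
    (ContinuousLinearMap.fst ℝ ℝ (ℝ × ℝ)).hasFDerivAt.comp_hasDerivAt t (hY t ht)
  have hsnd (t : ℝ) (ht : t ∈ I) :
      HasDerivAt (fun t => (Y t).2) (a t * (Y t).2.1 + b t * (Y t).1 + c t * (Y t).2.2, 0) t :=
    (ContinuousLinearMap.snd ℝ ℝ (ℝ × ℝ)).hasFDerivAt.comp_hasDerivAt t (hY t ht)
  have hconst : ∀ t ∈ ball t₀ r, (Y t).2.2 = 1 := by
    intro t ht
    have hderiv (s : ℝ) (hs : s ∈ ball t₀ r) : HasDerivAt (fun s => (Y s).2.2) 0 s :=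
      (ContinuousLinearMap.snd ℝ ℝ ℝ).hasFDerivAt.comp_hasDerivAt s (hsnd s (hrI hs))
    have heq := isOpen_ball.is_const_of_deriv_eq_zero (convex_ball t₀ r).isPreconnected
      (fun s hs => (hderiv s hs).differentiableAt.differentiableWithinAt)
      (fun s hs => (hderiv s hs).deriv) ht (mem_ball_self hr)
    simpa [hY₀] using heq
  refine ⟨ball t₀ r, fun t => (Y t).1, fun t => (Y t).2.1, isOpen_ball, mem_ball_self hr,
    hrI.trans hIT, by simp [hY₀], by simp [hY₀], contDiff_fst.comp_contDiffOn (hYsmooth.mono hrI),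
    fun t ht => hfst t (hrI ht), fun t ht => ?_⟩
  have hv : HasDerivAt (fun t => (Y t).2.1) (a t * (Y t).2.1 + b t * (Y t).1 + c t * (Y t).2.2) t :=
    (ContinuousLinearMap.fst ℝ ℝ ℝ).hasFDerivAt.comp_hasDerivAt t (hsnd t (hrI ht))
  simpa only [hconst t ht, mul_one] using hv

/-- The change of variables `t̃ = τ(t)`, `ũ = ρ(t) u + σ(t)` is invertible over `I` and maps
`u'' = a u' + b u + c` to `ũ'' = 0`: the last three fields compare the coefficients of `u'`, `u`
and `1` in `τ' ũ'' = τ'' ũ'`, where the primes are derivatives with respect to `t`. -/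
structure IsStraightening (I : Set ℝ) (a b c τ ρ σ : ℝ → ℝ) : Prop where
  smooth_τ : ContDiffOn ℝ ∞ τ I
  smooth_ρ : ContDiffOn ℝ ∞ ρ I
  smooth_σ : ContDiffOn ℝ ∞ σ I
  deriv_ne_zero : ∀ t ∈ I, deriv τ t ≠ 0
  ne_zero : ∀ t ∈ I, ρ t ≠ 0
  coeff_deriv : ∀ t ∈ I, deriv τ t * (ρ t * a t + 2 * deriv ρ t) = deriv (deriv τ) t * ρ t
  coeff_self : ∀ t ∈ I, deriv τ t * (ρ t * b t + deriv (deriv ρ) t) = deriv (deriv τ) t * deriv ρ t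
  coeff_one : ∀ t ∈ I, deriv τ t * (ρ t * c t + deriv (deriv σ) t) = deriv (deriv τ) t * deriv σ t

theorem deriv_deriv_div {I : Set ℝ} (hI : IsOpen I) {g g₁ u u₁ : ℝ → ℝ} {g₂ u₂ t : ℝ} (ht : t ∈ I)
    (hg : ∀ t ∈ I, HasDerivAt g (g₁ t) t) (hg₁ : HasDerivAt g₁ g₂ t)
    (hu : ∀ t ∈ I, HasDerivAt u (u₁ t) t) (hu₁ : HasDerivAt u₁ u₂ t) (h0 : ∀ t ∈ I, u t ≠ 0) :
    deriv (deriv fun t => g t / u t) t =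
      ((g₂ * u t - g t * u₂) * u t - 2 * (g₁ t * u t - g t * u₁ t) * u₁ t) / u t ^ 3 := by
  have hderiv : deriv (fun t => g t / u t) =ᶠ[𝓝 t]
      fun t => (g₁ t * u t - g t * u₁ t) / u t ^ 2 :=
    Filter.eventually_of_mem (hI.mem_nhds ht) fun s hs =>
      ((hg s hs).div (hu s hs) (h0 s hs)).deriv
  have hne := h0 t ht
  rw [hderiv.deriv_eq]
  refine (((hg₁.mul (hu t ht)).sub ((hg t ht).mul hu₁)).div ((hu t ht).pow 2)
    (pow_ne_zero 2 hne)).deriv.trans ?_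
  simp only [Pi.mul_apply, Pi.sub_apply, Pi.pow_apply]
  field_simp
  ring

/-- `ρ u + σ = (u - u₀) / u₂` and `τ = u₁ / u₂`, so that the solutions `u = u₀ + k₁ u₁ + k₂ u₂`
become the affine functions `k₁ τ + k₂`. -/
theorem isStraightening_of_solvesLinearODE {I : Set ℝ} (hI : IsOpen I)
    {a b c u₀ v₀ u₁ v₁ u₂ v₂ : ℝ → ℝ} (h₀ : SolvesLinearODE I a b c u₀ v₀)
    (h₁ : SolvesLinearODE I a b (fun _ => 0) u₁ v₁) (h₂ : SolvesLinearODE I a b (fun _ => 0) u₂ v₂)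
    (hu₂ : ∀ t ∈ I, u₂ t ≠ 0) (hW : ∀ t ∈ I, v₁ t * u₂ t - u₁ t * v₂ t ≠ 0) :
    IsStraightening I a b c (fun t => u₁ t / u₂ t) (fun t => 1 / u₂ t)
      (fun t => -u₀ t / u₂ t) := by
  have hτ (t : ℝ) (ht : t ∈ I) := ((h₁.hasDerivAt t ht).div (h₂.hasDerivAt t ht) (hu₂ t ht)).deriv
  have hρ (t : ℝ) (ht : t ∈ I) :=
    ((hasDerivAt_const t (1 : ℝ)).div (h₂.hasDerivAt t ht) (hu₂ t ht)).deriv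
  have hσ (t : ℝ) (ht : t ∈ I) :=
    ((h₀.hasDerivAt t ht).neg.div (h₂.hasDerivAt t ht) (hu₂ t ht)).deriv
  have hττ (t : ℝ) (ht : t ∈ I) := deriv_deriv_div hI ht h₁.hasDerivAt (h₁.hasDerivAt_deriv t ht)
    h₂.hasDerivAt (h₂.hasDerivAt_deriv t ht) hu₂
  have hρρ (t : ℝ) (ht : t ∈ I) := deriv_deriv_div hI ht (fun t _ => hasDerivAt_const t 1)
    (hasDerivAt_const t 0) h₂.hasDerivAt (h₂.hasDerivAt_deriv t ht) hu₂
  have hσσ (t : ℝ) (ht : t ∈ I) := deriv_deriv_div hI ht (fun t ht => (h₀.hasDerivAt t ht).neg)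
    (h₀.hasDerivAt_deriv t ht).neg h₂.hasDerivAt (h₂.hasDerivAt_deriv t ht) hu₂
  simp only [Pi.div_def, Pi.neg_apply] at hτ hρ hσ hττ hρρ hσσ
  constructor
  case smooth_τ => exact h₁.smooth.div h₂.smooth hu₂
  case smooth_ρ => exact contDiffOn_const.div h₂.smooth hu₂
  case smooth_σ => exact h₀.smooth.neg.div h₂.smooth hu₂
  case deriv_ne_zero =>
    intro t ht
    rw [hτ t ht]
    exact div_ne_zero (hW t ht) (pow_ne_zero 2 (hu₂ t ht))
  case ne_zero => exact fun t ht => one_div_ne_zero (hu₂ t ht)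
  all_goals
    intro t ht
    have hne := hu₂ t ht
    simp only [hτ t ht, hρ t ht, hσ t ht, hττ t ht, hρρ t ht, hσσ t ht]
    field_simp
    ring

theorem exists_isStraightening {a b c : ℝ → ℝ} {T : Set ℝ} (hT : IsOpen T)
    (ha : ContDiffOn ℝ ∞ a T) (hb : ContDiffOn ℝ ∞ b T) (hc : ContDiffOn ℝ ∞ c T) {t₀ : ℝ}
    (ht₀ : t₀ ∈ T) :
    ∃ (I : Set ℝ) (τ ρ σ : ℝ → ℝ), IsOpen I ∧ t₀ ∈ I ∧ I ⊆ T ∧ IsStraightening I a b c τ ρ σ := by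
  obtain ⟨I₀, u₀, v₀, hI₀, ht₀I₀, hI₀T, -, -, h₀⟩ := exists_solvesLinearODE hT ha hb hc ht₀ 0 0
  obtain ⟨I₁, u₁, v₁, hI₁, ht₀I₁, -, hu₁, hv₁, h₁⟩ :=
    exists_solvesLinearODE hT ha hb (contDiffOn_const (c := 0)) ht₀ 0 1
  obtain ⟨I₂, u₂, v₂, hI₂, ht₀I₂, -, hu₂, -, h₂⟩ :=
    exists_solvesLinearODE hT ha hb (contDiffOn_const (c := 0)) ht₀ 1 0
  have hI : IsOpen (I₀ ∩ I₁ ∩ I₂) := (hI₀.inter hI₁).inter hI₂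
  have hne : ∀ᶠ t in 𝓝 t₀, u₂ t ≠ 0 ∧ v₁ t * u₂ t - u₁ t * v₂ t ≠ 0 := by
    have hcont₁ := (h₁.hasDerivAt t₀ ht₀I₁).continuousAt
    have hcont₁' := (h₁.hasDerivAt_deriv t₀ ht₀I₁).continuousAt
    have hcont₂ := (h₂.hasDerivAt t₀ ht₀I₂).continuousAt
    have hcont₂' := (h₂.hasDerivAt_deriv t₀ ht₀I₂).continuousAt
    exact (hcont₂.eventually_ne (by simp [hu₂])).and
      (((hcont₁'.mul hcont₂).sub (hcont₁.mul hcont₂')).eventually_ne (by simp [hu₁, hu₂, hv₁]))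
  obtain ⟨I, hIsub, hIopen, ht₀I⟩ :=
    _root_.mem_nhds_iff.1 (Filter.inter_mem (hI.mem_nhds ⟨⟨ht₀I₀, ht₀I₁⟩, ht₀I₂⟩) hne)
  refine ⟨I, _, _, _, hIopen, ht₀I, fun t ht => hI₀T (hIsub ht).1.1.1,
    isStraightening_of_solvesLinearODE hIopen (h₀.mono fun t ht => (hIsub ht).1.1.1)
      (h₁.mono fun t ht => (hIsub ht).1.1.2) (h₂.mono fun t ht => (hIsub ht).1.2)
      (fun t ht => (hIsub ht).2.1) fun t ht => (hIsub ht).2.2⟩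

end LinearODE

/-! ### Partial and total derivatives -/

section PartialDerivatives

variable {V : Set (ℝ × ℝ)} {g h : ℝ × ℝ → ℝ} {m : ℝ × ℝ} {L : ℝ × ℝ →L[ℝ] ℝ}

theorem differentiableAt_of_contDiffOn {E F : Type*} [NormedAddCommGroup E] [NormedSpace ℝ E]
    [NormedAddCommGroup F] [NormedSpace ℝ F] {s : Set E} {f : E → F} {x : E} (hs : IsOpen s)
    (hf : ContDiffOn ℝ ∞ f s) (hx : x ∈ s) : DifferentiableAt ℝ f x :=
  (hf.contDiffAt (hs.mem_nhds hx)).differentiableAt (by simp)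

theorem dx_eq_of_hasFDerivAt (hg : HasFDerivAt g L m) : dx g m = L (1, 0) :=
  (hg.comp_hasDerivAt_of_eq m.1 ((hasDerivAt_id m.1).prodMk (hasDerivAt_const m.1 m.2)) rfl).deriv

theorem dy_eq_of_hasFDerivAt (hg : HasFDerivAt g L m) : dy g m = L (0, 1) :=
  (hg.comp_hasDerivAt_of_eq m.2 ((hasDerivAt_const m.2 m.1).prodMk (hasDerivAt_id m.2)) rfl).deriv

theorem apply_eq_of_hasFDerivAt (hg : HasFDerivAt g L m) (k : ℝ × ℝ) :
    L k = k.1 * dx g m + k.2 * dy g m := by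
  rw [dx_eq_of_hasFDerivAt hg, dy_eq_of_hasFDerivAt hg, ← smul_eq_mul, ← smul_eq_mul, ← map_smul,
    ← map_smul, ← map_add]
  simp

theorem hasDerivAt_dx (hg : DifferentiableAt ℝ g m) :
    HasDerivAt (fun s => g (s, m.2)) (dx g m) m.1 :=
  (DifferentiableAt.comp m.1 (g := g) (f := fun s => (s, m.2)) hg (by fun_prop)).hasDerivAt

theorem hasDerivAt_dy (hg : DifferentiableAt ℝ g m) :
    HasDerivAt (fun s => g (m.1, s)) (dy g m) m.2 :=
  (DifferentiableAt.comp m.2 (g := g) (f := fun s => (m.1, s)) hg (by fun_prop)).hasDerivAt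

theorem contDiffOn_dx (hV : IsOpen V) (hg : ContDiffOn ℝ ∞ g V) : ContDiffOn ℝ ∞ (dx g) V :=
  ((hg.fderiv_of_isOpen hV le_rfl).clm_apply contDiffOn_const).congr fun _ hm =>
    dx_eq_of_hasFDerivAt (differentiableAt_of_contDiffOn hV hg hm).hasFDerivAt

theorem contDiffOn_dy (hV : IsOpen V) (hg : ContDiffOn ℝ ∞ g V) : ContDiffOn ℝ ∞ (dy g) V :=
  ((hg.fderiv_of_isOpen hV le_rfl).clm_apply contDiffOn_const).congr fun _ hm =>
    dy_eq_of_hasFDerivAt (differentiableAt_of_contDiffOn hV hg hm).hasFDerivAt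

theorem dx_congr (hgh : g =ᶠ[𝓝 m] h) : dx g m = dx h m :=
  Filter.EventuallyEq.deriv_eq
    ((show Continuous fun s : ℝ => (s, m.2) by fun_prop).continuousAt.eventually hgh)

theorem dy_congr (hgh : g =ᶠ[𝓝 m] h) : dy g m = dy h m :=
  Filter.EventuallyEq.deriv_eq
    ((show Continuous fun s : ℝ => (m.1, s) by fun_prop).continuousAt.eventually hgh)

theorem dx_dy_comm (hV : IsOpen V) (hg : ContDiffOn ℝ ∞ g V) (hm : m ∈ V) :
    dx (dy g) m = dy (dx g) m := by
  have hdx : dx g =ᶠ[𝓝 m] fun m => fderiv ℝ g m (1, 0) :=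
    Filter.eventually_of_mem (hV.mem_nhds hm) fun _ hm =>
      dx_eq_of_hasFDerivAt (differentiableAt_of_contDiffOn hV hg hm).hasFDerivAt
  have hdy : dy g =ᶠ[𝓝 m] fun m => fderiv ℝ g m (0, 1) :=
    Filter.eventually_of_mem (hV.mem_nhds hm) fun _ hm =>
      dy_eq_of_hasFDerivAt (differentiableAt_of_contDiffOn hV hg hm).hasFDerivAt
  have hfderiv : HasFDerivAt (fderiv ℝ g) (fderiv ℝ (fderiv ℝ g) m) m :=
    (differentiableAt_of_contDiffOn hV (hg.fderiv_of_isOpen hV le_rfl) hm).hasFDerivAt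
  have hsymm := ((contDiffOn_infty.1 hg 2).contDiffAt (hV.mem_nhds hm)).isSymmSndFDerivAt (by simp)
  rw [dx_congr hdy, dy_congr hdx,
    dx_eq_of_hasFDerivAt (hfderiv.clm_apply (hasFDerivAt_const (0, 1) m)),
    dy_eq_of_hasFDerivAt (hfderiv.clm_apply (hasFDerivAt_const (1, 0) m))]
  simpa using hsymm (1, 0) (0, 1)

end PartialDerivatives

section TotalDerivatives

variable {G H : ℝ × ℝ × ℝ → ℝ} {G' H' : ℝ} {g : ℝ × ℝ → ℝ} {V : Set (ℝ × ℝ)} {j : ℝ × ℝ × ℝ} {q : ℝ}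

theorem contDiff_base : ContDiff ℝ ∞ base := by
  unfold base
  fun_prop

theorem base_eventually_mem (hV : IsOpen V) (hj : base j ∈ V) : ∀ᶠ i in 𝓝 j, base i ∈ V :=
  contDiff_base.continuous.continuousAt.eventually_mem (hV.mem_nhds hj)

/-- The function `G` of `(x, y, p)` is differentiable at `j`, and `G'` is its derivative
`D_x G = G_x + p G_y + q G_p` at the second order jet `(j, q)`. -/
def HasTotalDerivAt (G : ℝ × ℝ × ℝ → ℝ) (G' : ℝ) (j : ℝ × ℝ × ℝ) (q : ℝ) : Prop :=
  ∃ L : ℝ × ℝ × ℝ →L[ℝ] ℝ, HasFDerivAt G L j ∧ L (1, j.2.2, q) = G'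

theorem HasTotalDerivAt.total₁_eq (hG : HasTotalDerivAt G G' j q) : total₁ G j q = G' := by
  obtain ⟨L, hL, rfl⟩ := hG
  have hx : jx G j = L (1, 0, 0) :=
    (hL.comp_hasDerivAt_of_eq j.1 ((hasDerivAt_id j.1).prodMk (hasDerivAt_const j.1 j.2)) rfl).deriv
  have hy : jy G j = L (0, 1, 0) :=
    (hL.comp_hasDerivAt_of_eq j.2.1 ((hasDerivAt_const j.2.1 j.1).prodMk
      ((hasDerivAt_id j.2.1).prodMk (hasDerivAt_const j.2.1 j.2.2))) rfl).deriv
  have hp : jp G j = L (0, 0, 1) :=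
    (hL.comp_hasDerivAt_of_eq j.2.2 ((hasDerivAt_const j.2.2 j.1).prodMk
      ((hasDerivAt_const j.2.2 j.2.1).prodMk (hasDerivAt_id j.2.2))) rfl).deriv
  rw [total₁, hx, hy, hp, ← smul_eq_mul, ← smul_eq_mul, ← map_smul, ← map_smul, ← map_add,
    ← map_add]
  simp

theorem hasTotalDerivAt_total₁ (hG : DifferentiableAt ℝ G j) (q : ℝ) :
    HasTotalDerivAt G (total₁ G j q) j q :=
  ⟨_, hG.hasFDerivAt, (HasTotalDerivAt.total₁_eq ⟨_, hG.hasFDerivAt, rfl⟩).symm⟩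

theorem hasTotalDerivAt_base (hg : DifferentiableAt ℝ g (base j)) (q : ℝ) :
    HasTotalDerivAt (fun j => g (base j)) (total g j) j q := by
  have hbase := (hasFDerivAt_fst (𝕜 := ℝ) (p := j)).prodMk
    (hasFDerivAt_fst.comp j (hasFDerivAt_snd (𝕜 := ℝ) (p := j)))
  refine ⟨_, hg.hasFDerivAt.comp j hbase, (apply_eq_of_hasFDerivAt hg.hasFDerivAt _).trans ?_⟩
  simp [total]

theorem hasTotalDerivAt_fiber (j : ℝ × ℝ × ℝ) (q : ℝ) : HasTotalDerivAt (fun j => j.2.2) q j q :=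
  ⟨_, ((ContinuousLinearMap.snd ℝ ℝ ℝ).comp (ContinuousLinearMap.snd ℝ ℝ (ℝ × ℝ))).hasFDerivAt, rfl⟩

namespace HasTotalDerivAt

theorem congr (hG : HasTotalDerivAt G G' j q) (h : H =ᶠ[𝓝 j] G) : HasTotalDerivAt H G' j q :=
  hG.imp fun _ hL => ⟨hL.1.congr_of_eventuallyEq h, hL.2⟩

theorem neg (hG : HasTotalDerivAt G G' j q) : HasTotalDerivAt (fun j => -G j) (-G') j q := by
  obtain ⟨L, hL, rfl⟩ := hG
  exact ⟨_, hL.neg, rfl⟩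

theorem add (hG : HasTotalDerivAt G G' j q) (hH : HasTotalDerivAt H H' j q) :
    HasTotalDerivAt (fun j => G j + H j) (G' + H') j q := by
  obtain ⟨L, hL, rfl⟩ := hG
  obtain ⟨M, hM, rfl⟩ := hH
  exact ⟨_, hL.add hM, rfl⟩

theorem sub (hG : HasTotalDerivAt G G' j q) (hH : HasTotalDerivAt H H' j q) :
    HasTotalDerivAt (fun j => G j - H j) (G' - H') j q := by
  obtain ⟨L, hL, rfl⟩ := hG
  obtain ⟨M, hM, rfl⟩ := hH
  exact ⟨_, hL.sub hM, rfl⟩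

theorem mul (hG : HasTotalDerivAt G G' j q) (hH : HasTotalDerivAt H H' j q) :
    HasTotalDerivAt (fun j => G j * H j) (G' * H j + G j * H') j q := by
  obtain ⟨L, hL, rfl⟩ := hG
  obtain ⟨M, hM, rfl⟩ := hH
  refine ⟨_, hL.mul hM, ?_⟩
  simp only [add_apply, smul_apply, smul_eq_mul]
  ring

theorem scomp {τ : ℝ → ℝ} {τ' : ℝ} (hτ : HasDerivAt τ τ' (G j)) (hG : HasTotalDerivAt G G' j q) :
    HasTotalDerivAt (fun j => τ (G j)) (τ' * G') j q := by
  obtain ⟨L, hL, rfl⟩ := hG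
  exact ⟨_, hτ.comp_hasFDerivAt j hL, rfl⟩

theorem div (hG : HasTotalDerivAt G G' j q) (hH : HasTotalDerivAt H H' j q) (h0 : H j ≠ 0) :
    HasTotalDerivAt (fun j => G j / H j) ((G' * H j - G j * H') / H j ^ 2) j q := by
  have hdiv := hG.mul (scomp (hasDerivAt_inv h0) hH)
  simp only [← div_eq_mul_inv] at hdiv
  convert hdiv using 1
  field_simp
  ring

end HasTotalDerivAt

/-- The second total derivative `D_x² S = S_xx + 2 p S_xy + p² S_yy + q S_y`. -/
noncomputable def total₂ (S : ℝ × ℝ → ℝ) (j : ℝ × ℝ × ℝ) (q : ℝ) : ℝ :=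
  dx (dx S) (base j) + 2 * j.2.2 * dy (dx S) (base j) + j.2.2 ^ 2 * dy (dy S) (base j) +
    q * dy S (base j)

theorem hasTotalDerivAt_total (hV : IsOpen V) (hg : ContDiffOn ℝ ∞ g V) (hj : base j ∈ V) (q : ℝ) :
    HasTotalDerivAt (total g) (total₂ g j q) j q := by
  have hdx := hasTotalDerivAt_base (differentiableAt_of_contDiffOn hV (contDiffOn_dx hV hg) hj) q
  have hdy := hasTotalDerivAt_base (differentiableAt_of_contDiffOn hV (contDiffOn_dy hV hg) hj) q
  have htotal₂ : total₂ g j q =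
      total (dx g) j + (q * dy g (base j) + j.2.2 * total (dy g) j) := by
    rw [total₂, total, total, dx_dy_comm hV hg hj]
    ring
  rw [htotal₂]
  exact hdx.add ((hasTotalDerivAt_fiber j q).mul hdy)

theorem newDeriv₂_eq {φ ψ : ℝ × ℝ → ℝ} (hV : IsOpen V) (hφ : ContDiffOn ℝ ∞ φ V)
    (hψ : ContDiffOn ℝ ∞ ψ V) (hj : base j ∈ V) (h0 : total φ j ≠ 0) (q : ℝ) :
    newDeriv₂ φ ψ j q =
      (total φ j * total₂ ψ j q - total ψ j * total₂ φ j q) / total φ j ^ 3 := by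
  have hderiv :=
    (hasTotalDerivAt_total hV hψ hj q).div (hasTotalDerivAt_total hV hφ hj q) h0
  rw [newDeriv₂, show newDeriv φ ψ = fun j => total ψ j / total φ j from rfl, hderiv.total₁_eq]
  field_simp

end TotalDerivatives

/-! ### The determining equation -/

/-- The functions entering the criterion are smooth on `U`. -/
structure SmoothCoeffs (U : Set (ℝ × ℝ)) (F₃ F₂ F₁ F w z : ℝ × ℝ → ℝ) : Prop where
  smooth_F₃ : ContDiffOn ℝ ∞ F₃ U
  smooth_F₂ : ContDiffOn ℝ ∞ F₂ U
  smooth_F₁ : ContDiffOn ℝ ∞ F₁ U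
  smooth_F : ContDiffOn ℝ ∞ F U
  smooth_w : ContDiffOn ℝ ∞ w U
  smooth_z : ContDiffOn ℝ ∞ z U

/-- Over `U`, the equation `y'' = f(x, y, y')`, `(x, y, y') ∈ D`, is
`y'' + F₃ y'³ + F₂ y'² + F₁ y' + F = 0`. -/
def IsCubicOver (D : Set (ℝ × ℝ × ℝ)) (f : ℝ × ℝ × ℝ → ℝ) (U : Set (ℝ × ℝ))
    (F₃ F₂ F₁ F : ℝ × ℝ → ℝ) : Prop :=
  ∀ j ∈ D, base j ∈ U →
    f j + F₃ (base j) * j.2.2 ^ 3 + F₂ (base j) * j.2.2 ^ 2 + F₁ (base j) * j.2.2 + F (base j) = 0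

/-- The coefficient of `p²` in the determining equation of the pair `(∂_y, λ₁)`. -/
noncomputable def defect₂ (F₃ F₂ F₁ w z : ℝ × ℝ → ℝ) (m : ℝ × ℝ) : ℝ :=
  dy w m - dx F₃ m + F₃ m * (F₁ m - z m) - w m * (F₂ m - w m)

/-- The coefficient of `p` in the determining equation of the pair `(∂_y, λ₁)`. -/
noncomputable def defect₁ (F₃ F₂ F₁ F w z : ℝ × ℝ → ℝ) (m : ℝ × ℝ) : ℝ :=
  dx w m - dy z m + dy F₁ m - dx F₂ m + 2 * F₃ m * F m - 2 * w m * z m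

/-- The constant coefficient in the determining equation of the pair `(∂_y, λ₁)`. -/
noncomputable def defect₀ (F₂ F₁ F w z : ℝ × ℝ → ℝ) (m : ℝ × ℝ) : ℝ :=
  dy F m - dx z m + F m * (F₂ m - w m) + z m ^ 2 - z m * F₁ m

/-- At `m`, the coefficients of the determining equation of `(∂_y, λ₁)` vanish and the auxiliary
condition of the criterion holds. -/
structure IsFlatAt (F₃ F₂ F₁ F w z : ℝ × ℝ → ℝ) (m : ℝ × ℝ) : Prop where
  quadratic : defect₂ F₃ F₂ F₁ w z m = 0
  linear : defect₁ F₃ F₂ F₁ F w z m = 0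
  constant : defect₀ F₂ F₁ F w z m = 0
  auxiliary : dx w m + dy z m = (1 / 3) * (dx F₂ m + dy F₁ m)

section DeterminingEquation

variable {D : Set (ℝ × ℝ × ℝ)} {f : ℝ × ℝ × ℝ → ℝ} {U : Set (ℝ × ℝ)}
  {F₃ F₂ F₁ F w z : ℝ × ℝ → ℝ} {j : ℝ × ℝ × ℝ}

theorem SmoothCoeffs.mono {V : Set (ℝ × ℝ)} (h : SmoothCoeffs U F₃ F₂ F₁ F w z) (hVU : V ⊆ U) :
    SmoothCoeffs V F₃ F₂ F₁ F w z :=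
  ⟨h.smooth_F₃.mono hVU, h.smooth_F₂.mono hVU, h.smooth_F₁.mono hVU, h.smooth_F.mono hVU,
    h.smooth_w.mono hVU, h.smooth_z.mono hVU⟩

theorem Criterion.smoothCoeffs (h : Criterion D f U F₃ F₂ F₁ F w z) :
    SmoothCoeffs U F₃ F₂ F₁ F w z :=
  ⟨h.smooth_F₃, h.smooth_F₂, h.smooth_F₁, h.smooth_F, h.smooth_w, h.smooth_z⟩

section CanonicalPair

theorem prolong₁_canonical (l : ℝ × ℝ × ℝ → ℝ) : prolong₁ (fun _ => 0) (fun _ => 1) l = l := by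
  funext j
  simp [prolong₁, total, dx, dy]

theorem prolong₂_canonical (l : ℝ × ℝ × ℝ → ℝ) (j : ℝ × ℝ × ℝ) (q : ℝ) :
    prolong₂ (fun _ => 0) (fun _ => 1) l j q = total₁ l j q + l j ^ 2 := by
  rw [prolong₂, prolong₁_canonical]
  simp [total, dx, dy, pow_two]

variable {ξ η : ℝ × ℝ → ℝ} {l l' : ℝ × ℝ × ℝ → ℝ}

theorem PairEquiv.prolong₁_eq (h : PairEquiv D f U ξ η l (fun _ => 0) (fun _ => 1) l') (hj : j ∈ D)
    (hjU : base j ∈ U) :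
    prolong₁ ξ η l j = ξ (base j) * f j + (η (base j) - ξ (base j) * j.2.2) * l' j ∧
      η (base j) - ξ (base j) * j.2.2 ≠ 0 := by
  have hspan := h j hj hjU
  have hmem : prolongVec ξ η l j ∈
      Submodule.span ℝ {odeVec f j, prolongVec (fun _ => 0) (fun _ => 1) l' j} :=
    hspan ▸ Submodule.subset_span (by simp)
  have hmem' : prolongVec (fun _ => 0) (fun _ => 1) l' j ∈
      Submodule.span ℝ {odeVec f j, prolongVec ξ η l j} :=
    hspan ▸ Submodule.subset_span (by simp)
  obtain ⟨a, b, hab⟩ := Submodule.mem_span_pair.1 hmem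
  obtain ⟨c, d, hcd⟩ := Submodule.mem_span_pair.1 hmem'
  simp only [odeVec, prolongVec, prolong₁_canonical, Prod.smul_mk, Prod.mk_add_mk, smul_eq_mul,
    Prod.mk.injEq, mul_one, mul_zero, add_zero] at hab hcd
  obtain ⟨hξ, hη, hprolong⟩ := hab
  obtain ⟨hx, hy, -⟩ := hcd
  refine ⟨?_, fun h0 => zero_ne_one (α := ℝ) ?_⟩
  · rw [← hprolong, ← hη, ← hξ]
    ring
  · linear_combination hy - j.2.2 * hx - d * h0

theorem IsLambdaSymmetry.determining (hD : IsOpen D) (hU : IsOpen U)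
    (hs : IsLambdaSymmetry D f U ξ η l)
    (he : PairEquiv D f U ξ η l (fun _ => 0) (fun _ => 1) l') (hj : j ∈ D) (hjU : base j ∈ U)
    (hf : DifferentiableAt ℝ f j) (hl' : DifferentiableAt ℝ l' j) :
    total₁ l' j (f j) + l' j ^ 2 = jy f j + l' j * jp f j := by
  have hξ := hasTotalDerivAt_base (differentiableAt_of_contDiffOn hU hs.smooth_fst hjU) (f j)
  have hη := hasTotalDerivAt_base (differentiableAt_of_contDiffOn hU hs.smooth_snd hjU) (f j)
  have hprolong : prolong₁ ξ η l =ᶠ[𝓝 j]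
      fun j => ξ (base j) * f j + (η (base j) - ξ (base j) * j.2.2) * l' j := by
    filter_upwards [hD.mem_nhds hj, base_eventually_mem hU hjU] with i hi hiU
    exact (he.prolong₁_eq hi hiU).1
  have htotal := (((hξ.mul (hasTotalDerivAt_total₁ hf _)).add
    ((hη.sub (hξ.mul (hasTotalDerivAt_fiber j _))).mul (hasTotalDerivAt_total₁ hl' _))).congr
      hprolong).total₁_eq
  obtain ⟨hvalue, hne⟩ := he.prolong₁_eq hj hjU
  have hinv := hs.invariant j hj hjU (f j) rfl
  rw [prolong₂, htotal, hvalue, total₁.eq_1 f] at hinv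
  rw [prolong₁] at hvalue
  refine mul_left_cancel₀ hne ?_
  linear_combination hinv - l' j * hvalue

end CanonicalPair

theorem quadratic_coeffs_eq_zero {a b c p : ℝ} (h : ∀ᶠ s in 𝓝 p, a * s ^ 2 + b * s + c = 0) :
    a = 0 ∧ b = 0 ∧ c = 0 := by
  obtain ⟨ε, hε, h⟩ := Metric.eventually_nhds_iff_ball.1 h
  have hmid := h p (mem_ball_self hε)
  have hright := h (p + ε / 2) (by rw [mem_ball_iff_norm]; simp [abs_of_pos hε, hε])
  have hleft := h (p - ε / 2) (by rw [mem_ball_iff_norm]; simp [abs_of_pos hε, hε])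
  have ha : a = 0 := by
    have : a * ε ^ 2 = 0 := by linear_combination 2 * (hright + hleft - 2 * hmid)
    exact (mul_eq_zero.1 this).resolve_right (by positivity)
  subst ha
  have hb : b = 0 := by
    have : b * ε = 0 := by linear_combination hright - hleft
    exact (mul_eq_zero.1 this).resolve_right hε.ne'
  subst hb
  exact ⟨rfl, rfl, by linear_combination hmid⟩

section Defect

theorem contDiffOn_lambda₁ (h : SmoothCoeffs U F₃ F₂ F₁ F w z) :
    ContDiffOn ℝ ∞ (lambda₁ F₃ F₂ w z) (base ⁻¹' U) := by
  have hbase := contDiff_base.contDiffOn (s := base ⁻¹' U)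
  have hF₃ := h.smooth_F₃.comp hbase (mapsTo_preimage base U)
  have hF₂ := h.smooth_F₂.comp hbase (mapsTo_preimage base U)
  have hw := h.smooth_w.comp hbase (mapsTo_preimage base U)
  have hz := h.smooth_z.comp hbase (mapsTo_preimage base U)
  have hp : ContDiffOn ℝ ∞ (fun j : ℝ × ℝ × ℝ => j.2.2) (base ⁻¹' U) := by fun_prop
  exact ((hF₃.neg.mul (hp.pow 2)).sub ((hF₂.sub hw).mul hp)).sub hz

theorem IsCubicOver.eventuallyEq (hD : IsOpen D) (hU : IsOpen U)
    (hcubic : IsCubicOver D f U F₃ F₂ F₁ F) (hj : j ∈ D) (hjU : base j ∈ U) :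
    f =ᶠ[𝓝 j] fun j => -(F₃ (base j) * j.2.2 ^ 3 + F₂ (base j) * j.2.2 ^ 2 +
      F₁ (base j) * j.2.2 + F (base j)) := by
  filter_upwards [hD.mem_nhds hj, base_eventually_mem hU hjU] with i hi hiU
  linear_combination hcubic i hi hiU

theorem IsCubicOver.differentiableAt (hD : IsOpen D) (hU : IsOpen U)
    (h : SmoothCoeffs U F₃ F₂ F₁ F w z) (hcubic : IsCubicOver D f U F₃ F₂ F₁ F) (hj : j ∈ D)
    (hjU : base j ∈ U) : DifferentiableAt ℝ f j := by
  have hbase : DifferentiableAt ℝ base j := contDiff_base.differentiable (by simp) j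
  have hF₃ := (differentiableAt_of_contDiffOn hU h.smooth_F₃ hjU).comp j hbase
  have hF₂ := (differentiableAt_of_contDiffOn hU h.smooth_F₂ hjU).comp j hbase
  have hF₁ := (differentiableAt_of_contDiffOn hU h.smooth_F₁ hjU).comp j hbase
  have hF := (differentiableAt_of_contDiffOn hU h.smooth_F hjU).comp j hbase
  have hp : DifferentiableAt ℝ (fun j : ℝ × ℝ × ℝ => j.2.2) j := by fun_prop
  exact (((((hF₃.mul (hp.pow 3)).add (hF₂.mul (hp.pow 2))).add (hF₁.mul hp)).add hF).neg
    ).congr_of_eventuallyEq (hcubic.eventuallyEq hD hU hj hjU)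

theorem IsCubicOver.jy_eq (hD : IsOpen D) (hU : IsOpen U) (h : SmoothCoeffs U F₃ F₂ F₁ F w z)
    (hcubic : IsCubicOver D f U F₃ F₂ F₁ F) (hj : j ∈ D) (hjU : base j ∈ U) :
    jy f j = -(dy F₃ (base j) * j.2.2 ^ 3 + dy F₂ (base j) * j.2.2 ^ 2 + dy F₁ (base j) * j.2.2 +
      dy F (base j)) := by
  have hF₃ := hasDerivAt_dy (differentiableAt_of_contDiffOn hU h.smooth_F₃ hjU)
  have hF₂ := hasDerivAt_dy (differentiableAt_of_contDiffOn hU h.smooth_F₂ hjU)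
  have hF₁ := hasDerivAt_dy (differentiableAt_of_contDiffOn hU h.smooth_F₁ hjU)
  have hF := hasDerivAt_dy (differentiableAt_of_contDiffOn hU h.smooth_F hjU)
  have hfiber := (show Continuous fun s : ℝ => (j.1, s, j.2.2) by fun_prop).continuousAt.eventually
    (hcubic.eventuallyEq hD hU hj hjU)
  exact (Filter.EventuallyEq.deriv_eq hfiber).trans (((((hF₃.mul_const (j.2.2 ^ 3)).add
    (hF₂.mul_const (j.2.2 ^ 2))).add (hF₁.mul_const j.2.2)).add hF).neg.deriv)

theorem IsCubicOver.jp_eq (hD : IsOpen D) (hU : IsOpen U)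
    (hcubic : IsCubicOver D f U F₃ F₂ F₁ F) (hj : j ∈ D) (hjU : base j ∈ U) :
    jp f j = -(3 * F₃ (base j) * j.2.2 ^ 2 + 2 * F₂ (base j) * j.2.2 + F₁ (base j)) := by
  have hfiber := (show Continuous fun s : ℝ => (j.1, j.2.1, s) by fun_prop).continuousAt.eventually
    (hcubic.eventuallyEq hD hU hj hjU)
  refine (Filter.EventuallyEq.deriv_eq hfiber).trans
    ((((((hasDerivAt_pow 3 j.2.2).const_mul (F₃ (base j))).add
      ((hasDerivAt_pow 2 j.2.2).const_mul (F₂ (base j)))).add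
      ((hasDerivAt_id j.2.2).const_mul (F₁ (base j)))).add_const (F (base j))).neg.deriv.trans ?_)
  push_cast
  ring

theorem total₁_lambda₁ (hU : IsOpen U) (h : SmoothCoeffs U F₃ F₂ F₁ F w z) (hj : base j ∈ U)
    (q : ℝ) :
    total₁ (lambda₁ F₃ F₂ w z) j q =
      -total F₃ j * j.2.2 ^ 2 - (total F₂ j - total w j) * j.2.2 - total z j -
        q * (2 * F₃ (base j) * j.2.2 + (F₂ (base j) - w (base j))) := by
  have hF₃ := hasTotalDerivAt_base (differentiableAt_of_contDiffOn hU h.smooth_F₃ hj) q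
  have hF₂ := hasTotalDerivAt_base (differentiableAt_of_contDiffOn hU h.smooth_F₂ hj) q
  have hw := hasTotalDerivAt_base (differentiableAt_of_contDiffOn hU h.smooth_w hj) q
  have hz := hasTotalDerivAt_base (differentiableAt_of_contDiffOn hU h.smooth_z hj) q
  have hp := hasTotalDerivAt_fiber j q
  have hp2 := hp.scomp (hasDerivAt_pow 2 j.2.2)
  refine ((hF₃.neg.mul hp2).sub ((hF₂.sub hw).mul hp)).sub hz |>.total₁_eq.trans ?_
  push_cast
  ring

theorem IsCubicOver.determining_eq_defect (hD : IsOpen D) (hU : IsOpen U)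
    (h : SmoothCoeffs U F₃ F₂ F₁ F w z) (hcubic : IsCubicOver D f U F₃ F₂ F₁ F) (hj : j ∈ D)
    (hjU : base j ∈ U) :
    total₁ (lambda₁ F₃ F₂ w z) j (f j) + lambda₁ F₃ F₂ w z j ^ 2 -
        (jy f j + lambda₁ F₃ F₂ w z j * jp f j) =
      defect₂ F₃ F₂ F₁ w z (base j) * j.2.2 ^ 2 + defect₁ F₃ F₂ F₁ F w z (base j) * j.2.2 +
        defect₀ F₂ F₁ F w z (base j) := by
  rw [total₁_lambda₁ hU h hjU, hcubic.jy_eq hD hU h hj hjU, hcubic.jp_eq hD hU hj hjU]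
  simp only [total, lambda₁, defect₂, defect₁, defect₀]
  linear_combination (-(2 * F₃ (base j) * j.2.2 + (F₂ (base j) - w (base j)))) * hcubic j hj hjU

theorem Criterion.isFlatAt (hD : IsOpen D) (hU : IsOpen U)
    (h : Criterion D f U F₃ F₂ F₁ F w z) (hj : j ∈ D) (hjU : base j ∈ U) :
    IsFlatAt F₃ F₂ F₁ F w z (base j) := by
  obtain ⟨ξ, η, l, hs, he⟩ := h.symmetry
  have hcubic : IsCubicOver D f U F₃ F₂ F₁ F := h.cubic
  have hpoly : ∀ᶠ s in 𝓝 j.2.2, defect₂ F₃ F₂ F₁ w z (base j) * s ^ 2 +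
      defect₁ F₃ F₂ F₁ F w z (base j) * s + defect₀ F₂ F₁ F w z (base j) = 0 := by
    filter_upwards [(show Continuous fun s : ℝ => (j.1, j.2.1, s) by fun_prop).continuousAt
      (hD.mem_nhds hj)] with s hs'
    have hdiff := differentiableAt_of_contDiffOn (hU.preimage contDiff_base.continuous)
      (contDiffOn_lambda₁ h.smoothCoeffs) (x := (j.1, j.2.1, s)) hjU
    have hdet := hs.determining hD hU he hs' hjU
      (hcubic.differentiableAt hD hU h.smoothCoeffs hs' hjU) hdiff
    exact (hcubic.determining_eq_defect hD hU h.smoothCoeffs hs' hjU).symm.trans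
      (sub_eq_zero.2 hdet)
  obtain ⟨hquadratic, hlinear, hconstant⟩ := quadratic_coeffs_eq_zero hpoly
  exact ⟨hquadratic, hlinear, hconstant, h.auxiliary _ hjU⟩

theorem criterion_of_isFlatAt (hD : IsOpen D) (hU : IsOpen U)
    (h : SmoothCoeffs U F₃ F₂ F₁ F w z) (hcubic : IsCubicOver D f U F₃ F₂ F₁ F)
    (hflat : ∀ m ∈ U, IsFlatAt F₃ F₂ F₁ F w z m) : Criterion D f U F₃ F₂ F₁ F w z := by
  refine ⟨h.smooth_F₃, h.smooth_F₂, h.smooth_F₁, h.smooth_F, h.smooth_w, h.smooth_z, hcubic,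
    ⟨fun _ => 0, fun _ => 1, lambda₁ F₃ F₂ w z, ⟨contDiffOn_const, contDiffOn_const,
      (contDiffOn_lambda₁ h).mono inter_subset_right, ?_⟩, fun _ _ _ => rfl⟩,
    fun m hm => (hflat m hm).auxiliary⟩
  rintro j hj hjU q rfl
  have hdet := hcubic.determining_eq_defect hD hU h hj hjU
  rw [(hflat _ hjU).quadratic, (hflat _ hjU).linear, (hflat _ hjU).constant] at hdet
  rw [prolong₂_canonical, prolong₁_canonical]
  linear_combination hdet

end Defect

end DeterminingEquation

/-! ### Solutions of the system -/

section System

variable {F₃ F₂ F₁ F w z φ ψ S : ℝ × ℝ → ℝ} {U V : Set (ℝ × ℝ)} {m m₀ : ℝ × ℝ}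

/-- The connection form of the system, at `m`: on `(S, P, Q)`-space, `S` solves the system if and
only if `Y = (S, S_x, S_y)` solves the total differential equation `dY = connection · Y`. -/
noncomputable def connection (F₃ F₂ F₁ F w z : ℝ × ℝ → ℝ) (m : ℝ × ℝ) :
    ℝ × ℝ →L[ℝ] ℝ × ℝ × ℝ →L[ℝ] ℝ × ℝ × ℝ :=
  LinearMap.toContinuousBilinearMap <| LinearMap.mk₂ ℝ
    (fun k Y => (k.1 * Y.2.1 + k.2 * Y.2.2,
      k.1 * ((2 * z m - F₁ m) * Y.2.1 + F m * Y.2.2) + k.2 * (z m * Y.2.2 - w m * Y.2.1),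
      k.1 * (z m * Y.2.2 - w m * Y.2.1) + k.2 * ((F₂ m - 2 * w m) * Y.2.2 - F₃ m * Y.2.1)))
    (fun k l Y => by ext <;> simp <;> ring) (fun r k Y => by ext <;> simp <;> ring)
    (fun k Y Z => by ext <;> simp <;> ring) (fun r k Y => by ext <;> simp <;> ring)

theorem connection_apply (k : ℝ × ℝ) (Y : ℝ × ℝ × ℝ) :
    connection F₃ F₂ F₁ F w z m k Y =
      (k.1 * Y.2.1 + k.2 * Y.2.2,
        k.1 * ((2 * z m - F₁ m) * Y.2.1 + F m * Y.2.2) + k.2 * (z m * Y.2.2 - w m * Y.2.1),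
        k.1 * (z m * Y.2.2 - w m * Y.2.1) + k.2 * ((F₂ m - 2 * w m) * Y.2.2 - F₃ m * Y.2.1)) :=
  rfl

theorem contDiffOn_connection (h : SmoothCoeffs U F₃ F₂ F₁ F w z) :
    ContDiffOn ℝ ∞ (connection F₃ F₂ F₁ F w z) U := by
  obtain ⟨hF₃, hF₂, hF₁, hF, hw, hz⟩ := h
  refine contDiffOn_clm_apply.2 fun k => contDiffOn_clm_apply.2 fun Y => ?_
  simp only [connection_apply]
  fun_prop

theorem fderiv_connection_apply (hU : IsOpen U) (hC : SmoothCoeffs U F₃ F₂ F₁ F w z) (hm : m ∈ U)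
    (h k : ℝ × ℝ) (Y : ℝ × ℝ × ℝ) :
    fderiv ℝ (connection F₃ F₂ F₁ F w z) m h k Y =
      (0,
        k.1 * ((2 * fderiv ℝ z m h - fderiv ℝ F₁ m h) * Y.2.1 + fderiv ℝ F m h * Y.2.2) +
          k.2 * (fderiv ℝ z m h * Y.2.2 - fderiv ℝ w m h * Y.2.1),
        k.1 * (fderiv ℝ z m h * Y.2.2 - fderiv ℝ w m h * Y.2.1) +
          k.2 * ((fderiv ℝ F₂ m h - 2 * fderiv ℝ w m h) * Y.2.2 - fderiv ℝ F₃ m h * Y.2.1)) := by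
  have hconn := (differentiableAt_of_contDiffOn hU (contDiffOn_connection hC) hm).hasFDerivAt
  have hF₃ := (differentiableAt_of_contDiffOn hU hC.smooth_F₃ hm).hasFDerivAt
  have hF₂ := (differentiableAt_of_contDiffOn hU hC.smooth_F₂ hm).hasFDerivAt
  have hF₁ := (differentiableAt_of_contDiffOn hU hC.smooth_F₁ hm).hasFDerivAt
  have hF := (differentiableAt_of_contDiffOn hU hC.smooth_F hm).hasFDerivAt
  have hw := (differentiableAt_of_contDiffOn hU hC.smooth_w hm).hasFDerivAt
  have hz := (differentiableAt_of_contDiffOn hU hC.smooth_z hm).hasFDerivAt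
  have hxy := (hz.mul_const Y.2.2).sub (hw.mul_const Y.2.1)
  have hxx := (((hz.const_mul 2).sub hF₁).mul_const Y.2.1).add (hF.mul_const Y.2.2)
  have hyy := ((hF₂.sub (hw.const_mul 2)).mul_const Y.2.2).sub (hF₃.mul_const Y.2.1)
  have happly := (hconn.clm_apply (hasFDerivAt_const k m)).clm_apply (hasFDerivAt_const Y m)
  have hunique := happly.unique <| (hasFDerivAt_const (k.1 * Y.2.1 + k.2 * Y.2.2) m).prodMk
    (((hxx.const_mul k.1).add (hxy.const_mul k.2)).prodMk
      ((hxy.const_mul k.1).add (hyy.const_mul k.2)))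
  have hvalue := congrArg (fun L => L h) hunique
  simp only [ContinuousLinearMap.comp_zero, zero_add, ContinuousLinearMap.flip_apply, smul_add,
    ContinuousLinearMap.prod_apply, zero_apply, add_apply, smul_apply, sub_apply,
    smul_eq_mul] at hvalue
  rw [hvalue]
  simp only [Prod.mk.injEq, true_and]
  constructor <;> ring

theorem isFlatOn_connection (hU : IsOpen U) (hC : SmoothCoeffs U F₃ F₂ F₁ F w z)
    (hflat : ∀ m ∈ U, IsFlatAt F₃ F₂ F₁ F w z m) : IsFlatOn (connection F₃ F₂ F₁ F w z) U := by
  intro m hm h k Y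
  obtain ⟨hquadratic, hlinear, hconstant, hauxiliary⟩ := hflat m hm
  have hF₃ := (differentiableAt_of_contDiffOn hU hC.smooth_F₃ hm).hasFDerivAt
  have hF₂ := (differentiableAt_of_contDiffOn hU hC.smooth_F₂ hm).hasFDerivAt
  have hF₁ := (differentiableAt_of_contDiffOn hU hC.smooth_F₁ hm).hasFDerivAt
  have hF := (differentiableAt_of_contDiffOn hU hC.smooth_F hm).hasFDerivAt
  have hw := (differentiableAt_of_contDiffOn hU hC.smooth_w hm).hasFDerivAt
  have hz := (differentiableAt_of_contDiffOn hU hC.smooth_z hm).hasFDerivAt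
  simp only [fderiv_connection_apply hU hC hm, connection_apply, apply_eq_of_hasFDerivAt hF₃,
    apply_eq_of_hasFDerivAt hF₂, apply_eq_of_hasFDerivAt hF₁, apply_eq_of_hasFDerivAt hF,
    apply_eq_of_hasFDerivAt hw, apply_eq_of_hasFDerivAt hz, Prod.mk_add_mk, Prod.mk.injEq]
  unfold defect₂ at hquadratic
  unfold defect₁ at hlinear
  unfold defect₀ at hconstant
  refine ⟨by ring, ?_, ?_⟩
  · linear_combination (h.1 * k.2 - h.2 * k.1) *
      ((hlinear / 2 - 3 / 2 * hauxiliary) * Y.2.1 - hconstant * Y.2.2)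
  · linear_combination (h.1 * k.2 - h.2 * k.1) *
      (hquadratic * Y.2.1 - (hlinear / 2 + 3 / 2 * hauxiliary) * Y.2.2)

theorem solvesSystem_of_hasFDerivAt (hV : IsOpen V) (hC : SmoothCoeffs V F₃ F₂ F₁ F w z)
    {Y : ℝ × ℝ → ℝ × ℝ × ℝ}
    (hY : ∀ m ∈ V, HasFDerivAt Y ((connection F₃ F₂ F₁ F w z m).flip (Y m)) m) :
    SolvesSystem V F₃ F₂ F₁ F w z (fun m => (Y m).1) ∧
      ∀ m ∈ V, (dx (fun m => (Y m).1) m, dy (fun m => (Y m).1) m) = (Y m).2 := by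
  have hS (m) (hm : m ∈ V) := (hY m hm).fst
  have hP (m) (hm : m ∈ V) := (hY m hm).snd.fst
  have hQ (m) (hm : m ∈ V) := (hY m hm).snd.snd
  have hdx (m) (hm : m ∈ V) : dx (fun m => (Y m).1) m = (Y m).2.1 := by
    simpa [connection_apply] using dx_eq_of_hasFDerivAt (hS m hm)
  have hdy (m) (hm : m ∈ V) : dy (fun m => (Y m).1) m = (Y m).2.2 := by
    simpa [connection_apply] using dy_eq_of_hasFDerivAt (hS m hm)
  refine ⟨⟨(contDiffOn_of_hasFDerivAt_flip hV (contDiffOn_connection hC) hY).fst, fun m hm => ?_,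
    fun m hm => ?_, fun m hm => ?_⟩, fun m hm => Prod.ext (hdx m hm) (hdy m hm)⟩
  · rw [dy_congr (Filter.eventually_of_mem (hV.mem_nhds hm) hdy), hdx m hm, hdy m hm,
      dy_eq_of_hasFDerivAt (hQ m hm)]
    simp only [ContinuousLinearMap.comp_apply, ContinuousLinearMap.flip_apply, connection_apply,
      zero_mul, one_mul, zero_add, ContinuousLinearMap.coe_snd']
    ring
  · rw [dy_congr (Filter.eventually_of_mem (hV.mem_nhds hm) hdx), hdx m hm, hdy m hm,
      dy_eq_of_hasFDerivAt (hP m hm)]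
    simp [connection_apply]
  · rw [dx_congr (Filter.eventually_of_mem (hV.mem_nhds hm) hdx), hdx m hm, hdy m hm,
      dx_eq_of_hasFDerivAt (hP m hm)]
    simp only [ContinuousLinearMap.comp_apply, ContinuousLinearMap.flip_apply, connection_apply,
      one_mul, zero_mul, add_zero, ContinuousLinearMap.coe_snd', ContinuousLinearMap.coe_fst']
    ring

theorem exists_solvesSystem (hU : IsOpen U) (hC : SmoothCoeffs U F₃ F₂ F₁ F w z)
    (hflat : ∀ m ∈ U, IsFlatAt F₃ F₂ F₁ F w z m) (hm₀ : m₀ ∈ U) (P₀ Q₀ : ℝ) :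
    ∃ (V : Set (ℝ × ℝ)) (S : ℝ × ℝ → ℝ), IsOpen V ∧ m₀ ∈ V ∧ V ⊆ U ∧
      SolvesSystem V F₃ F₂ F₁ F w z S ∧ dx S m₀ = P₀ ∧ dy S m₀ = Q₀ := by
  obtain ⟨V, Y, hV, hm₀V, hVU, hY₀, hY⟩ := exists_hasFDerivAt_flip_of_isFlatOn hU
    (contDiffOn_infty.1 (contDiffOn_connection hC) 2) (isFlatOn_connection hU hC hflat) hm₀
    (0, P₀, Q₀)
  obtain ⟨hS, hpartials⟩ := solvesSystem_of_hasFDerivAt hV (hC.mono hVU) hY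
  have hm₀' := hpartials m₀ hm₀V
  rw [hY₀, Prod.mk.injEq] at hm₀'
  exact ⟨V, fun m => (Y m).1, hV, hm₀V, hVU, hS, hm₀'.1, hm₀'.2⟩

theorem SolvesSystem.mono (h : SolvesSystem U F₃ F₂ F₁ F w z S) (hVU : V ⊆ U) :
    SolvesSystem V F₃ F₂ F₁ F w z S :=
  ⟨h.smooth.mono hVU, fun m hm => h.eq_yy m (hVU hm), fun m hm => h.eq_xy m (hVU hm),
    fun m hm => h.eq_xx m (hVU hm)⟩

theorem contDiffOn_jacobian (hV : IsOpen V) (hφ : ContDiffOn ℝ ∞ φ V) (hψ : ContDiffOn ℝ ∞ ψ V) :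
    ContDiffOn ℝ ∞ (jacobian φ ψ) V :=
  ((contDiffOn_dx hV hφ).mul (contDiffOn_dy hV hψ)).sub
    ((contDiffOn_dy hV hφ).mul (contDiffOn_dx hV hψ))

theorem exists_independent_solutions (hU : IsOpen U) (hC : SmoothCoeffs U F₃ F₂ F₁ F w z)
    (hflat : ∀ m ∈ U, IsFlatAt F₃ F₂ F₁ F w z m) (hm₀ : m₀ ∈ U) :
    ∃ (V : Set (ℝ × ℝ)) (φ ψ : ℝ × ℝ → ℝ), IsOpen V ∧ m₀ ∈ V ∧ V ⊆ U ∧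
      SolvesSystem V F₃ F₂ F₁ F w z φ ∧ SolvesSystem V F₃ F₂ F₁ F w z ψ ∧
      ∀ m ∈ V, jacobian φ ψ m ≠ 0 := by
  obtain ⟨V, φ, hV, hm₀V, hVU, hφ, hφx, hφy⟩ := exists_solvesSystem hU hC hflat hm₀ 1 0
  obtain ⟨W, ψ, hW, hm₀W, -, hψ, hψx, hψy⟩ := exists_solvesSystem hU hC hflat hm₀ 0 1
  have hφ' := hφ.mono (inter_subset_left (t := W))
  have hψ' := hψ.mono (inter_subset_right (s := V))
  have hJ := (contDiffOn_jacobian (hV.inter hW) hφ'.smooth hψ'.smooth).continuousOn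
  exact ⟨V ∩ W ∩ jacobian φ ψ ⁻¹' {0}ᶜ, φ, ψ,
    hJ.isOpen_inter_preimage (hV.inter hW) isOpen_compl_singleton,
    ⟨⟨hm₀V, hm₀W⟩, by simp [jacobian, hφx, hφy, hψx, hψy]⟩, fun m hm => hVU hm.1.1,
    hφ'.mono inter_subset_left, hψ'.mono inter_subset_left, fun m hm => hm.2⟩

theorem Criterion.exists_independent_solutions {D : Set (ℝ × ℝ × ℝ)} {f : ℝ × ℝ × ℝ → ℝ}
    (hD : IsOpen D) (hU : IsOpen U) (h : Criterion D f U F₃ F₂ F₁ F w z) {j : ℝ × ℝ × ℝ}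
    (hj : j ∈ D) (hjU : base j ∈ U) :
    ∃ (V : Set (ℝ × ℝ)) (φ ψ : ℝ × ℝ → ℝ), IsOpen V ∧ base j ∈ V ∧ V ⊆ U ∧
      SolvesSystem V F₃ F₂ F₁ F w z φ ∧ SolvesSystem V F₃ F₂ F₁ F w z ψ ∧
      ∀ m ∈ V, jacobian φ ψ m ≠ 0 := by
  have hslice : IsOpen (U ∩ (fun m : ℝ × ℝ => (m.1, m.2, j.2.2)) ⁻¹' D) :=
    hU.inter (hD.preimage (by fun_prop))
  obtain ⟨V, φ, ψ, hV, hjV, hVU, hsolves⟩ := PointLin.exists_independent_solutions hslice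
    (h.smoothCoeffs.mono inter_subset_left)
    (fun m hm => h.isFlatAt hD hU (j := (m.1, m.2, j.2.2)) hm.2 hm.1) (m₀ := base j) ⟨hjU, hj⟩
  exact ⟨V, φ, ψ, hV, hjV, hVU.trans inter_subset_left, hsolves⟩

end System

/-! ### Transformations to the free particle equation -/

section FreeParticle

variable {D : Set (ℝ × ℝ × ℝ)} {f : ℝ × ℝ × ℝ → ℝ} {F₃ F₂ F₁ F w z φ ψ : ℝ × ℝ → ℝ}
  {V : Set (ℝ × ℝ)} {j : ℝ × ℝ × ℝ}

theorem SolvesSystem.newDeriv₂_eq (hV : IsOpen V) (hφ : SolvesSystem V F₃ F₂ F₁ F w z φ)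
    (hψ : SolvesSystem V F₃ F₂ F₁ F w z ψ) (hj : base j ∈ V) (h0 : total φ j ≠ 0) (q : ℝ) :
    newDeriv₂ φ ψ j q = jacobian φ ψ (base j) * (q + F₃ (base j) * j.2.2 ^ 3 +
      F₂ (base j) * j.2.2 ^ 2 + F₁ (base j) * j.2.2 + F (base j)) / total φ j ^ 3 := by
  rw [PointLin.newDeriv₂_eq hV hφ.smooth hψ.smooth hj h0]
  congr 1
  simp only [total, total₂, jacobian]
  linear_combination
    (dx φ (base j) + j.2.2 * dy φ (base j)) *
      (hψ.eq_xx _ hj + 2 * j.2.2 * hψ.eq_xy _ hj + j.2.2 ^ 2 * hψ.eq_yy _ hj) -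
    (dx ψ (base j) + j.2.2 * dy ψ (base j)) *
      (hφ.eq_xx _ hj + 2 * j.2.2 * hφ.eq_xy _ hj + j.2.2 ^ 2 * hφ.eq_yy _ hj)

theorem transformsTo_of_solvesSystem (hV : IsOpen V) (hcubic : IsCubicOver D f V F₃ F₂ F₁ F)
    (hφ : SolvesSystem V F₃ F₂ F₁ F w z φ) (hψ : SolvesSystem V F₃ F₂ F₁ F w z ψ)
    (hJ : ∀ m ∈ V, jacobian φ ψ m ≠ 0) :
    TransformsTo D f V φ ψ (fun _ => 0) (fun _ => 0) (fun _ => 0) := by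
  intro j hj hjV h0 q
  have hf := hcubic j hj hjV
  rw [hφ.newDeriv₂_eq hV hψ hjV h0, zero_mul, zero_mul, add_zero, add_zero,
    div_eq_zero_iff, or_iff_left (pow_ne_zero 3 h0), mul_eq_zero, or_iff_right (hJ _ hjV)]
  exact ⟨fun h => by linear_combination h + hf, fun h => by linear_combination h - hf⟩

end FreeParticle

section Straightening

variable {φ ψ g : ℝ × ℝ → ℝ} {V : Set (ℝ × ℝ)}
  {j : ℝ × ℝ × ℝ} {q G' : ℝ} {I : Set ℝ} {a b c τ ρ σ : ℝ → ℝ}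

theorem HasTotalDerivAt.total_eq (h : HasTotalDerivAt (fun j => g (base j)) G' j q)
    (hg : DifferentiableAt ℝ g (base j)) : total g j = G' :=
  (hasTotalDerivAt_base hg q).total₁_eq.symm.trans h.total₁_eq

theorem hasTotalDerivAt_newDeriv (hV : IsOpen V) (hφ : ContDiffOn ℝ ∞ φ V)
    (hψ : ContDiffOn ℝ ∞ ψ V) (hj : base j ∈ V) (h0 : total φ j ≠ 0) (q : ℝ) :
    HasTotalDerivAt (newDeriv φ ψ) (newDeriv₂ φ ψ j q * total φ j) j q := by
  have hderiv := (hasTotalDerivAt_total hV hψ hj q).div (hasTotalDerivAt_total hV hφ hj q) h0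
  rw [newDeriv₂, div_mul_cancel₀ _ h0]
  exact (hderiv.total₁_eq ▸ hderiv :)

namespace IsStraightening

theorem total_fst (h : IsStraightening I a b c τ ρ σ) (hI : IsOpen I) (hV : IsOpen V)
    (hφ : ContDiffOn ℝ ∞ φ V) (hφI : MapsTo φ V I) (hj : base j ∈ V) :
    total (fun m => τ (φ m)) j = deriv τ (φ (base j)) * total φ j :=
  HasTotalDerivAt.total_eq (q := 0)
    (.scomp (differentiableAt_of_contDiffOn hI h.smooth_τ (hφI hj)).hasDerivAt
      (hasTotalDerivAt_base (differentiableAt_of_contDiffOn hV hφ hj) 0))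
    (differentiableAt_of_contDiffOn hV (h.smooth_τ.comp hφ hφI) hj)

theorem contDiffOn_snd (h : IsStraightening I a b c τ ρ σ) (hφ : ContDiffOn ℝ ∞ φ V)
    (hψ : ContDiffOn ℝ ∞ ψ V) (hφI : MapsTo φ V I) :
    ContDiffOn ℝ ∞ (fun m => ρ (φ m) * ψ m + σ (φ m)) V :=
  ((h.smooth_ρ.comp hφ hφI).mul hψ).add (h.smooth_σ.comp hφ hφI)

theorem total_snd (h : IsStraightening I a b c τ ρ σ) (hI : IsOpen I) (hV : IsOpen V)
    (hφ : ContDiffOn ℝ ∞ φ V) (hψ : ContDiffOn ℝ ∞ ψ V) (hφI : MapsTo φ V I) (hj : base j ∈ V) :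
    total (fun m => ρ (φ m) * ψ m + σ (φ m)) j =
      deriv ρ (φ (base j)) * total φ j * ψ (base j) + ρ (φ (base j)) * total ψ j +
        deriv σ (φ (base j)) * total φ j := by
  have hφ' := hasTotalDerivAt_base (differentiableAt_of_contDiffOn hV hφ hj) 0
  have hψ' := hasTotalDerivAt_base (differentiableAt_of_contDiffOn hV hψ hj) 0
  have hρ := (differentiableAt_of_contDiffOn hI h.smooth_ρ (hφI hj)).hasDerivAt
  have hσ := (differentiableAt_of_contDiffOn hI h.smooth_σ (hφI hj)).hasDerivAt
  exact (((HasTotalDerivAt.scomp hρ hφ').mul hψ').add (.scomp hσ hφ')).total_eq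
    (differentiableAt_of_contDiffOn hV (h.contDiffOn_snd hφ hψ hφI) hj)

theorem newDeriv_eq (h : IsStraightening I a b c τ ρ σ) (hI : IsOpen I) (hV : IsOpen V)
    (hφ : ContDiffOn ℝ ∞ φ V) (hψ : ContDiffOn ℝ ∞ ψ V) (hφI : MapsTo φ V I) (hj : base j ∈ V)
    (h0 : total φ j ≠ 0) :
    newDeriv (fun m => τ (φ m)) (fun m => ρ (φ m) * ψ m + σ (φ m)) j =
      (ρ (φ (base j)) * newDeriv φ ψ j + deriv ρ (φ (base j)) * ψ (base j) +
        deriv σ (φ (base j))) / deriv τ (φ (base j)) := by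
  have hτ := h.deriv_ne_zero _ (hφI hj)
  rw [newDeriv, h.total_fst hI hV hφ hφI hj, h.total_snd hI hV hφ hψ hφI hj, newDeriv]
  field_simp
  ring

theorem newDeriv₂_eq (h : IsStraightening I a b c τ ρ σ) (hI : IsOpen I) (hV : IsOpen V)
    (hφ : ContDiffOn ℝ ∞ φ V) (hψ : ContDiffOn ℝ ∞ ψ V) (hφI : MapsTo φ V I) (hj : base j ∈ V)
    (h0 : total φ j ≠ 0) (q : ℝ) :
    newDeriv₂ (fun m => τ (φ m)) (fun m => ρ (φ m) * ψ m + σ (φ m)) j q =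
      ρ (φ (base j)) / deriv τ (φ (base j)) ^ 2 * (newDeriv₂ φ ψ j q -
        (a (φ (base j)) * newDeriv φ ψ j + b (φ (base j)) * ψ (base j) + c (φ (base j)))) := by
  have hφ' := hasTotalDerivAt_base (differentiableAt_of_contDiffOn hV hφ hj) q
  have hψ' := hasTotalDerivAt_base (differentiableAt_of_contDiffOn hV hψ hj) q
  have hcomp {g : ℝ → ℝ} (hg : ContDiffOn ℝ ∞ g I) :
      HasTotalDerivAt (fun j => g (φ (base j))) (deriv g (φ (base j)) * total φ j) j q :=
    .scomp (differentiableAt_of_contDiffOn hI hg (hφI hj)).hasDerivAt hφ'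
  have hτ'' := hcomp (h.smooth_τ.deriv_of_isOpen hI le_rfl)
  have hρ'' := hcomp (h.smooth_ρ.deriv_of_isOpen hI le_rfl)
  have hσ'' := hcomp (h.smooth_σ.deriv_of_isOpen hI le_rfl)
  have hnear : ∀ᶠ i in 𝓝 j, total φ i ≠ 0 := by
    obtain ⟨L, hL, -⟩ := hasTotalDerivAt_total hV hφ hj q
    exact hL.continuousAt.eventually_ne h0
  have heq := (base_eventually_mem hV hj).and hnear |>.mono fun i hi =>
    h.newDeriv_eq hI hV hφ hψ hφI hi.1 hi.2
  have hτ := h.deriv_ne_zero _ (hφI hj)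
  have hderiv := ((((hcomp h.smooth_ρ).mul (hasTotalDerivAt_newDeriv hV hφ hψ hj h0 q)).add
    (hρ''.mul hψ')).add hσ'').div hτ'' hτ |>.congr heq
  rw [newDeriv₂, hderiv.total₁_eq, h.total_fst hI hV hφ hφI hj, ← div_mul_cancel₀ (total ψ j) h0,
    ← newDeriv]
  have ha := h.coeff_deriv _ (hφI hj)
  have hb := h.coeff_self _ (hφI hj)
  have hc := h.coeff_one _ (hφI hj)
  field_simp
  linear_combination newDeriv φ ψ j * ha + ψ (base j) * hb + hc

theorem jacobian_eq (h : IsStraightening I a b c τ ρ σ) (hI : IsOpen I) (hV : IsOpen V)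
    (hφ : ContDiffOn ℝ ∞ φ V) (hψ : ContDiffOn ℝ ∞ ψ V) (hφI : MapsTo φ V I) {m : ℝ × ℝ}
    (hm : m ∈ V) :
    jacobian (fun m => τ (φ m)) (fun m => ρ (φ m) * ψ m + σ (φ m)) m =
      deriv τ (φ m) * ρ (φ m) * jacobian φ ψ m := by
  -- The total derivatives at the jets `p = 0` and `p = 1` determine `dx` and `dy`.
  have hfst₀ := h.total_fst hI hV hφ hφI (j := (m.1, m.2, 0)) hm
  have hfst₁ := h.total_fst hI hV hφ hφI (j := (m.1, m.2, 1)) hm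
  have hsnd₀ := h.total_snd hI hV hφ hψ hφI (j := (m.1, m.2, 0)) hm
  have hsnd₁ := h.total_snd hI hV hφ hψ hφI (j := (m.1, m.2, 1)) hm
  simp only [total, base, zero_mul, one_mul, add_zero, Prod.mk.eta] at hfst₀ hfst₁ hsnd₀ hsnd₁
  rw [hfst₀] at hfst₁
  rw [hsnd₀] at hsnd₁
  rw [jacobian, hfst₀, hsnd₀, jacobian]
  linear_combination deriv τ (φ m) * dx φ m * hsnd₁ -
    (deriv ρ (φ m) * dx φ m * ψ m + ρ (φ m) * dx ψ m + deriv σ (φ m) * dx φ m) * hfst₁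

end IsStraightening

end Straightening

/-! ### Necessity of the criterion -/

section Necessity

variable {D : Set (ℝ × ℝ × ℝ)} {f : ℝ × ℝ × ℝ → ℝ} {F₃ F₂ F₁ F w z φ ψ S : ℝ × ℝ → ℝ}
  {V : Set (ℝ × ℝ)} {m : ℝ × ℝ}

theorem LinearizableAt.exists_transformsTo_free {m₀ : ℝ × ℝ} (h : LinearizableAt D f m₀) :
    ∃ (V : Set (ℝ × ℝ)) (φ ψ : ℝ × ℝ → ℝ), IsOpen V ∧ m₀ ∈ V ∧ IsPointTransformation V φ ψ ∧
      TransformsTo D f V φ ψ (fun _ => 0) (fun _ => 0) (fun _ => 0) := by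
  obtain ⟨U, φ, ψ, T, a, b, c, hU, hm₀, ⟨hφ, hψ, hJ⟩, hT, hφT, ha, hb, hc, htr⟩ := h
  obtain ⟨I, τ, ρ, σ, hI, hI₀, -, hs⟩ := exists_isStraightening hT ha hb hc (hφT hm₀)
  have hV : IsOpen (U ∩ φ ⁻¹' I) := hφ.continuousOn.isOpen_inter_preimage hU hI
  have hφI : MapsTo φ (U ∩ φ ⁻¹' I) I := fun _ hm => hm.2
  have hφV := hφ.mono (inter_subset_left : U ∩ φ ⁻¹' I ⊆ U)
  have hψV := hψ.mono (inter_subset_left : U ∩ φ ⁻¹' I ⊆ U)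
  refine ⟨U ∩ φ ⁻¹' I, fun m => τ (φ m), fun m => ρ (φ m) * ψ m + σ (φ m), hV, ⟨hm₀, hI₀⟩,
    ⟨hs.smooth_τ.comp hφV hφI, hs.contDiffOn_snd hφV hψV hφI, fun m hm => ?_⟩,
    fun j hj hjV h0 q => ?_⟩
  · rw [hs.jacobian_eq hI hV hφV hψV hφI hm]
    exact mul_ne_zero (mul_ne_zero (hs.deriv_ne_zero _ hm.2) (hs.ne_zero _ hm.2)) (hJ m hm.1)
  · rw [hs.total_fst hI hV hφV hφI hjV] at h0
    have hφ0 := right_ne_zero_of_mul h0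
    rw [htr j hj hjV.1 hφ0 q, hs.newDeriv₂_eq hI hV hφV hψV hφI hjV hφ0, zero_mul, zero_mul,
      add_zero, add_zero, mul_eq_zero, or_iff_right (div_ne_zero (hs.ne_zero _ hjV.2)
        (pow_ne_zero 2 (hs.deriv_ne_zero _ hjV.2))), sub_eq_zero]

theorem IsPointTransformation.exists_smooth_cramer {H K : ℝ × ℝ → ℝ} (hV : IsOpen V)
    (hT : IsPointTransformation V φ ψ) (hH : ContDiffOn ℝ ∞ H V) (hK : ContDiffOn ℝ ∞ K V) :
    ∃ g k : ℝ × ℝ → ℝ, ContDiffOn ℝ ∞ g V ∧ ContDiffOn ℝ ∞ k V ∧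
      ∀ m ∈ V, g m * dx φ m + k m * dy φ m = H m ∧ g m * dx ψ m + k m * dy ψ m = K m := by
  have hJ := contDiffOn_jacobian hV hT.smooth_fst hT.smooth_snd
  refine ⟨fun m => (H m * dy ψ m - K m * dy φ m) / jacobian φ ψ m,
    fun m => (dx φ m * K m - dx ψ m * H m) / jacobian φ ψ m,
    ((hH.mul (contDiffOn_dy hV hT.smooth_snd)).sub
      (hK.mul (contDiffOn_dy hV hT.smooth_fst))).div hJ hT.jacobian_ne,
    (((contDiffOn_dx hV hT.smooth_fst).mul hK).sub
      ((contDiffOn_dx hV hT.smooth_snd).mul hH)).div hJ hT.jacobian_ne, fun m hm => ?_⟩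
  have h0 := hT.jacobian_ne m hm
  constructor <;>
  · field_simp
    rw [jacobian]
    ring

theorem IsPointTransformation.exists_smoothCoeffs (hV : IsOpen V)
    (hT : IsPointTransformation V φ ψ) :
    ∃ F₃ F₂ F₁ F w z : ℝ × ℝ → ℝ, SmoothCoeffs V F₃ F₂ F₁ F w z ∧
      SolvesSystem V F₃ F₂ F₁ F w z φ ∧ SolvesSystem V F₃ F₂ F₁ F w z ψ := by
  have hφx := contDiffOn_dx hV hT.smooth_fst
  have hψx := contDiffOn_dx hV hT.smooth_snd
  obtain ⟨gxx, kxx, hgxx, hkxx, hxx⟩ :=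
    hT.exists_smooth_cramer hV (contDiffOn_dx hV hφx) (contDiffOn_dx hV hψx)
  obtain ⟨gxy, kxy, hgxy, hkxy, hxy⟩ :=
    hT.exists_smooth_cramer hV (contDiffOn_dy hV hφx) (contDiffOn_dy hV hψx)
  obtain ⟨gyy, kyy, hgyy, hkyy, hyy⟩ :=
    hT.exists_smooth_cramer hV (contDiffOn_dy hV (contDiffOn_dy hV hT.smooth_fst))
      (contDiffOn_dy hV (contDiffOn_dy hV hT.smooth_snd))
  refine ⟨fun m => -gyy m, fun m => kyy m - 2 * gxy m, fun m => 2 * kxy m - gxx m, kxx,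
    fun m => -gxy m, kxy,
    ⟨hgyy.neg, hkyy.sub (contDiffOn_const.mul hgxy), (contDiffOn_const.mul hkxy).sub hgxx, hkxx,
      hgxy.neg, hkxy⟩,
    ⟨hT.smooth_fst, fun m hm => ?_, fun m hm => ?_, fun m hm => ?_⟩,
    ⟨hT.smooth_snd, fun m hm => ?_, fun m hm => ?_, fun m hm => ?_⟩⟩
  · linear_combination -(hyy m hm).1
  · linear_combination -(hxy m hm).1
  · linear_combination -(hxx m hm).1
  · linear_combination -(hyy m hm).2
  · linear_combination -(hxy m hm).2
  · linear_combination -(hxx m hm).2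

theorem SolvesSystem.compatibility_xxy (hV : IsOpen V) (hC : SmoothCoeffs V F₃ F₂ F₁ F w z)
    (hS : SolvesSystem V F₃ F₂ F₁ F w z S) (hm : m ∈ V) :
    (2 * dy z m - dy F₁ m + dx w m + w m * z m - F m * F₃ m) * dx S m +
      defect₀ F₂ F₁ F w z m * dy S m = 0 := by
  have hdiff {g : ℝ × ℝ → ℝ} (hg : ContDiffOn ℝ ∞ g V) := differentiableAt_of_contDiffOn hV hg hm
  have hSx := hdiff (contDiffOn_dx hV hS.smooth)
  have hSy := hdiff (contDiffOn_dy hV hS.smooth)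
  have hxx : dx (dx S) =ᶠ[𝓝 m] fun m => (2 * z m - F₁ m) * dx S m + F m * dy S m := by
    filter_upwards [hV.mem_nhds hm] with i hi
    linear_combination hS.eq_xx i hi
  have hxy : dy (dx S) =ᶠ[𝓝 m] fun m => z m * dy S m - w m * dx S m := by
    filter_upwards [hV.mem_nhds hm] with i hi
    linear_combination hS.eq_xy i hi
  have hxxy := (dy_congr hxx).trans
    ((((hasDerivAt_dy (hdiff hC.smooth_z)).const_mul 2 |>.sub
      (hasDerivAt_dy (hdiff hC.smooth_F₁))).mul (hasDerivAt_dy hSx)).add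
      ((hasDerivAt_dy (hdiff hC.smooth_F)).mul (hasDerivAt_dy hSy))).deriv
  have hxyx := (dx_congr hxy).trans
    (((hasDerivAt_dx (hdiff hC.smooth_z)).mul (hasDerivAt_dx hSy)).sub
      ((hasDerivAt_dx (hdiff hC.smooth_w)).mul (hasDerivAt_dx hSx))).deriv
  have hcomm := dx_dy_comm hV (contDiffOn_dx hV hS.smooth) hm
  rw [hxxy, hxyx, dx_dy_comm hV hS.smooth hm] at hcomm
  simp only [Pi.sub_apply, Prod.mk.eta] at hcomm
  rw [defect₀]
  linear_combination -hcomm - F m * hS.eq_yy m hm + (F₁ m - z m) * hS.eq_xy m hm -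
    w m * hS.eq_xx m hm

theorem SolvesSystem.compatibility_xyy (hV : IsOpen V) (hC : SmoothCoeffs V F₃ F₂ F₁ F w z)
    (hS : SolvesSystem V F₃ F₂ F₁ F w z S) (hm : m ∈ V) :
    defect₂ F₃ F₂ F₁ w z m * dx S m +
      (dx F₂ m - 2 * dx w m - dy z m - F₃ m * F m + w m * z m) * dy S m = 0 := by
  have hdiff {g : ℝ × ℝ → ℝ} (hg : ContDiffOn ℝ ∞ g V) := differentiableAt_of_contDiffOn hV hg hm
  have hSx := hdiff (contDiffOn_dx hV hS.smooth)
  have hSy := hdiff (contDiffOn_dy hV hS.smooth)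
  have hyy : dy (dy S) =ᶠ[𝓝 m] fun m => (F₂ m - 2 * w m) * dy S m - F₃ m * dx S m := by
    filter_upwards [hV.mem_nhds hm] with i hi
    linear_combination hS.eq_yy i hi
  have hxy : dx (dy S) =ᶠ[𝓝 m] fun m => z m * dy S m - w m * dx S m := by
    filter_upwards [hV.mem_nhds hm] with i hi
    linear_combination dx_dy_comm hV hS.smooth hi + hS.eq_xy i hi
  have hyyx := (dx_congr hyy).trans
    (((hasDerivAt_dx (hdiff hC.smooth_F₂)).sub ((hasDerivAt_dx (hdiff hC.smooth_w)).const_mul 2)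
      |>.mul (hasDerivAt_dx hSy)).sub
      ((hasDerivAt_dx (hdiff hC.smooth_F₃)).mul (hasDerivAt_dx hSx))).deriv
  have hxyy := (dy_congr hxy).trans
    (((hasDerivAt_dy (hdiff hC.smooth_z)).mul (hasDerivAt_dy hSy)).sub
      ((hasDerivAt_dy (hdiff hC.smooth_w)).mul (hasDerivAt_dy hSx))).deriv
  have hcomm := dx_dy_comm hV (contDiffOn_dy hV hS.smooth) hm
  rw [hyyx, hxyy, dx_dy_comm hV hS.smooth hm] at hcomm
  simp only [Pi.sub_apply, Prod.mk.eta] at hcomm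
  rw [defect₂]
  linear_combination hcomm + z m * hS.eq_yy m hm - (F₂ m - w m) * hS.eq_xy m hm +
    F₃ m * hS.eq_xx m hm

theorem eq_zero_of_jacobian_ne {a b : ℝ} (hJ : jacobian φ ψ m ≠ 0)
    (hφ : a * dx φ m + b * dy φ m = 0) (hψ : a * dx ψ m + b * dy ψ m = 0) : a = 0 ∧ b = 0 := by
  rw [jacobian] at hJ
  constructor
  · refine (mul_eq_zero.1 ?_).resolve_right hJ
    linear_combination dy ψ m * hφ - dy φ m * hψ
  · refine (mul_eq_zero.1 ?_).resolve_right hJ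
    linear_combination dx φ m * hψ - dx ψ m * hφ

theorem SolvesSystem.isFlatAt (hV : IsOpen V) (hC : SmoothCoeffs V F₃ F₂ F₁ F w z)
    (hφ : SolvesSystem V F₃ F₂ F₁ F w z φ) (hψ : SolvesSystem V F₃ F₂ F₁ F w z ψ) (hm : m ∈ V)
    (hJ : jacobian φ ψ m ≠ 0) : IsFlatAt F₃ F₂ F₁ F w z m := by
  obtain ⟨hlinear, hconstant⟩ := eq_zero_of_jacobian_ne hJ
    (hφ.compatibility_xxy hV hC hm) (hψ.compatibility_xxy hV hC hm)
  obtain ⟨hquadratic, hlinear'⟩ := eq_zero_of_jacobian_ne hJ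
    (hφ.compatibility_xyy hV hC hm) (hψ.compatibility_xyy hV hC hm)
  refine ⟨hquadratic, ?_, hconstant, ?_⟩
  · rw [defect₁]
    linear_combination -hlinear - hlinear'
  · linear_combination (hlinear - hlinear') / 3

theorem dy_ne_zero_of_total_eq_zero {j : ℝ × ℝ × ℝ} (hJ : jacobian φ ψ (base j) ≠ 0)
    (h0 : total φ j = 0) : dy φ (base j) ≠ 0 := by
  intro hy
  have hx : dx φ (base j) = 0 := by rwa [total, hy, mul_zero, add_zero] at h0
  exact hJ (by rw [jacobian, hx, hy, zero_mul, zero_mul, sub_zero])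

/-- On each fibre over the base, `total φ` is affine in `p` and, the Jacobian being nonzero, has at
most one zero. -/
theorem eq_zero_of_total_ne {W : Set (ℝ × ℝ × ℝ)} (hW : IsOpen W) {G : ℝ × ℝ × ℝ → ℝ}
    (hG : ContinuousOn G W) (h : ∀ j ∈ W, total φ j ≠ 0 → G j = 0) {j : ℝ × ℝ × ℝ} (hj : j ∈ W)
    (hJ : jacobian φ ψ (base j) ≠ 0) : G j = 0 := by
  by_cases h0 : total φ j = 0
  swap
  · exact h j hj h0
  have hfiber : ContinuousAt (fun s : ℝ => (j.1, j.2.1, s)) j.2.2 := by fun_prop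
  have hlim : Filter.Tendsto (fun s => G (j.1, j.2.1, s)) (𝓝[≠] j.2.2) (𝓝 (G j)) :=
    (ContinuousAt.comp (g := G) (hG.continuousAt (hW.mem_nhds hj)) hfiber).tendsto.mono_left
      nhdsWithin_le_nhds
  refine tendsto_nhds_unique (hlim.congr' ?_) tendsto_const_nhds
  filter_upwards [nhdsWithin_le_nhds (hfiber.eventually_mem (hW.mem_nhds hj)), self_mem_nhdsWithin]
    with s hs hne
  have hsub : total φ (j.1, j.2.1, s) - total φ j = (s - j.2.2) * dy φ (base j) := by
    simp only [total, base]
    ring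
  rw [h0, sub_zero] at hsub
  exact h _ hs
    (hsub ▸ mul_ne_zero (sub_ne_zero.2 hne) (dy_ne_zero_of_total_eq_zero hJ h0))

theorem isCubicOver_of_transformsTo (hD : IsOpen D) (hf : ContinuousOn f D) (hV : IsOpen V)
    (hC : SmoothCoeffs V F₃ F₂ F₁ F w z) (hφ : SolvesSystem V F₃ F₂ F₁ F w z φ)
    (hψ : SolvesSystem V F₃ F₂ F₁ F w z ψ) (hJ : ∀ m ∈ V, jacobian φ ψ m ≠ 0)
    (htr : TransformsTo D f V φ ψ (fun _ => 0) (fun _ => 0) (fun _ => 0)) :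
    IsCubicOver D f V F₃ F₂ F₁ F := by
  intro j hj hjV
  have hcont {g : ℝ × ℝ → ℝ} (hg : ContDiffOn ℝ ∞ g V) :
      ContinuousOn (fun j => g (base j)) (D ∩ base ⁻¹' V) :=
    hg.continuousOn.comp contDiff_base.continuous.continuousOn fun _ hi => hi.2
  have hp : ContinuousOn (fun j : ℝ × ℝ × ℝ => j.2.2) (D ∩ base ⁻¹' V) := by fun_prop
  have hpoly := ((((hf.mono inter_subset_left).add ((hcont hC.smooth_F₃).mul (hp.pow 3))).add
    ((hcont hC.smooth_F₂).mul (hp.pow 2))).add ((hcont hC.smooth_F₁).mul hp)).add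
      (hcont hC.smooth_F)
  refine eq_zero_of_total_ne (hD.inter (hV.preimage contDiff_base.continuous)) hpoly ?_ ⟨hj, hjV⟩
    (hJ _ hjV)
  rintro i ⟨hi, hiV⟩ h0
  have hfree := (htr i hi hiV h0 (f i)).1 rfl
  rw [hφ.newDeriv₂_eq hV hψ hiV h0, zero_mul, zero_mul, add_zero, add_zero, div_eq_zero_iff,
    or_iff_left (pow_ne_zero 3 h0), mul_eq_zero, or_iff_right (hJ _ hiV)] at hfree
  exact hfree

theorem LinearizableAt.exists_criterion (hD : IsOpen D) (hf : ContinuousOn f D) {m₀ : ℝ × ℝ}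
    (h : LinearizableAt D f m₀) :
    ∃ (U : Set (ℝ × ℝ)) (F₃ F₂ F₁ F w z : ℝ × ℝ → ℝ),
      IsOpen U ∧ m₀ ∈ U ∧ Criterion D f U F₃ F₂ F₁ F w z := by
  obtain ⟨V, φ, ψ, hV, hm₀, hT, htr⟩ := h.exists_transformsTo_free
  obtain ⟨F₃, F₂, F₁, F, w, z, hC, hφ, hψ⟩ := hT.exists_smoothCoeffs hV
  exact ⟨V, F₃, F₂, F₁, F, w, z, hV, hm₀, criterion_of_isFlatAt hD hV hC
    (isCubicOver_of_transformsTo hD hf hV hC hφ hψ hT.jacobian_ne htr)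
    fun m hm => hφ.isFlatAt hV hC hψ hm (hT.jacobian_ne m hm)⟩

end Necessity

theorem LinearizableAt.of_criterion {D : Set (ℝ × ℝ × ℝ)} (hD : IsOpen D) {f : ℝ × ℝ × ℝ → ℝ}
    {U : Set (ℝ × ℝ)} (hU : IsOpen U) {F₃ F₂ F₁ F w z : ℝ × ℝ → ℝ}
    (h : Criterion D f U F₃ F₂ F₁ F w z) {j : ℝ × ℝ × ℝ} (hj : j ∈ D) (hjU : base j ∈ U) :
    LinearizableAt D f (base j) := by
  obtain ⟨V, φ, ψ, hV, hjV, hVU, hφ, hψ, hJ⟩ := h.exists_independent_solutions hD hU hj hjU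
  exact ⟨V, φ, ψ, univ, _, _, _, hV, hjV, ⟨hφ.smooth, hψ.smooth, hJ⟩, isOpen_univ,
    mapsTo_univ _ _, contDiffOn_const, contDiffOn_const, contDiffOn_const,
    transformsTo_of_solvesSystem hV (fun i hi hiV => h.cubic i hi (hVU hiV)) hφ hψ hJ⟩

end PointLin

theorem mainTheorem2_general (D : Set (ℝ × ℝ × ℝ)) (hD : IsOpen D) (f : ℝ × ℝ × ℝ → ℝ)
    (hf : ContinuousOn f D) (m₀ : ℝ × ℝ) (hm₀ : ∃ j ∈ D, PointLin.base j = m₀) :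
    (PointLin.LinearizableAt D f m₀ ↔
      ∃ (U : Set (ℝ × ℝ)) (F₃ F₂ F₁ F w z : ℝ × ℝ → ℝ),
        IsOpen U ∧ m₀ ∈ U ∧ PointLin.Criterion D f U F₃ F₂ F₁ F w z) ∧
    (∀ (U : Set (ℝ × ℝ)) (F₃ F₂ F₁ F w z : ℝ × ℝ → ℝ),
      IsOpen U → m₀ ∈ U → PointLin.Criterion D f U F₃ F₂ F₁ F w z →
        (∃ (V : Set (ℝ × ℝ)) (φ ψ : ℝ × ℝ → ℝ),
          IsOpen V ∧ m₀ ∈ V ∧ V ⊆ U ∧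
          PointLin.SolvesSystem V F₃ F₂ F₁ F w z φ ∧
          PointLin.SolvesSystem V F₃ F₂ F₁ F w z ψ ∧
          ∀ m ∈ V, PointLin.jacobian φ ψ m ≠ 0) ∧
        (∀ (V : Set (ℝ × ℝ)) (φ ψ : ℝ × ℝ → ℝ),
          IsOpen V → V ⊆ U →
          PointLin.SolvesSystem V F₃ F₂ F₁ F w z φ →
          PointLin.SolvesSystem V F₃ F₂ F₁ F w z ψ →
          (∀ m ∈ V, PointLin.jacobian φ ψ m ≠ 0) →
          PointLin.TransformsTo D f V φ ψ (fun _ => 0) (fun _ => 0) (fun _ => 0))) := by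
  obtain ⟨j, hj, rfl⟩ := hm₀
  refine ⟨⟨fun h => h.exists_criterion hD hf, ?_⟩, fun U F₃ F₂ F₁ F w z hU hjU hC => ⟨?_, ?_⟩⟩
  · rintro ⟨U, F₃, F₂, F₁, F, w, z, hU, hjU, hC⟩
    exact PointLin.LinearizableAt.of_criterion hD hU hC hj hjU
  · exact hC.exists_independent_solutions hD hU hj hjU
  · intro V φ ψ hV hVU hφ hψ hJ
    exact PointLin.transformsTo_of_solvesSystem hV
      (fun i hi hiV => hC.cubic i hi (hVU hiV)) hφ hψ hJ

theorem mainTheorem2 (D : Set (ℝ × ℝ × ℝ)) (hD : IsOpen D) (f : ℝ × ℝ × ℝ → ℝ)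
    (hf : ContDiffOn ℝ ∞ f D) (m₀ : ℝ × ℝ) (hm₀ : ∃ j ∈ D, PointLin.base j = m₀) :
    (PointLin.LinearizableAt D f m₀ ↔
      ∃ (U : Set (ℝ × ℝ)) (F₃ F₂ F₁ F w z : ℝ × ℝ → ℝ),
        IsOpen U ∧ m₀ ∈ U ∧ PointLin.Criterion D f U F₃ F₂ F₁ F w z) ∧
    (∀ (U : Set (ℝ × ℝ)) (F₃ F₂ F₁ F w z : ℝ × ℝ → ℝ),
      IsOpen U → m₀ ∈ U → PointLin.Criterion D f U F₃ F₂ F₁ F w z →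
        (∃ (V : Set (ℝ × ℝ)) (φ ψ : ℝ × ℝ → ℝ),
          IsOpen V ∧ m₀ ∈ V ∧ V ⊆ U ∧
          PointLin.SolvesSystem V F₃ F₂ F₁ F w z φ ∧
          PointLin.SolvesSystem V F₃ F₂ F₁ F w z ψ ∧
          ∀ m ∈ V, PointLin.jacobian φ ψ m ≠ 0) ∧
        (∀ (V : Set (ℝ × ℝ)) (φ ψ : ℝ × ℝ → ℝ),
          IsOpen V → V ⊆ U →
          PointLin.SolvesSystem V F₃ F₂ F₁ F w z φ →
          PointLin.SolvesSystem V F₃ F₂ F₁ F w z ψ →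
          (∀ m ∈ V, PointLin.jacobian φ ψ m ≠ 0) →
          PointLin.TransformsTo D f V φ ψ (fun _ => 0) (fun _ => 0) (fun _ => 0))) :=
  mainTheorem2_general D hD f hf.continuousOn m₀ hm₀
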